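/- Let $\Delta=(\delta_i)_{i\in I}$ be a finite relational type with all arities $\delta_i\ge 1$. A structure $\mathbf A$ of type $\Delta$ is a vertex set $A$ with relations $R^i_{\mathbf A}\subseteq A^{\delta_i}$, $i\in I$. Substructures are induced substructures, embeddings are isomorphisms onto induced substructures, and a copy of $\mathbf R$ in a vertex set is the image of an embedding of $\mathbf R$ contained in that set. Let $\mathcal F$ be a finite family of finite nonempty structures which is minimal: every member is a core (each of its endomorphisms is an automorphism), and there is no homomorphism between two different members. Let $\mathrm{Forb}_h(\mathcal F)$ be the class of all countable structures $\mathbf M$ such that no $\mathbf F\in\mathcal F$ has a homomorphism to $\mathbf M$. A universal structure for $\mathrm{Forb}_h(\mathcal F)$ is a member of this class into which every member of the class embeds. The Gaifman graph of $\mathbf A$ has vertex set $A$, two distinct vertices being adjacent when they occur together in a tuple of some relation of $\mathbf A$; $\mathbf A$ is connected if its Gaifman graph is connected. A cut of $\mathbf A$ is a set $C\subseteq A$ whose removal leaves the Gaifman graph disconnected (with at least two components); a minimal cut is an inclusion-minimal one. A homomorphic image of $\mathbf F$ is a structure $\mathbf A$ with a surjective homomorphism $\mathbf F\to\mathbf A$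 such that the tuples of $\mathbf A$ are exactly the images of tuples of $\mathbf F$. It is a minimal homomorphic image of $\mathbf F\in\mathcal F$ if moreover every proper substructure of $\mathbf A$ belongs to $\mathrm{Forb}_h(\mathcal F)$. A structure $\mathbf U$ is weakly indivisible if for every partition of its vertex set into $A$ and $B$ such that some finite substructure of $\mathbf U$ has no copy in $A$, there is a copy of $\mathbf U$ in $B$. It is divisible if its vertex set can be partitioned into two sets neither of which contains a copy of $\mathbf U$. 1. Suppose that all one-vertex structures in $\mathrm{Forb}_h(\mathcal F)$ are isomorphic (equivalently, no structure in $\mathrm{Forb}_h(\mathcal F)$ has a constant tuple $(x,\dots,x)$ in one of its relations). If every minimal cut $C$ of every homomorphic image $\mathbf A$ of every $\mathbf F\in\mathcal F$ has at least 2 vertices, and the structure induced by $\mathbf A$ on $C$ is connected and has no cut of size 1, then there is a universal structure for $\mathrm{Forb}_h(\mathcal F)$ that is weakly indivisible. 2. If some minimal homomorphic image of some $\mathbf F\in\mathcal F$ has a cut of size 1, then every universal structure for $\mathrm{Forb}_h(\mathcal F)$ is divisible, and it is not weakly indivisible. -/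

import Mathlib

open FirstOrder

namespace WeakIndiv

section Basic

variable (L : FirstOrder.Language.{0, 0}) (A : Type) [L.Structure A]

/-- The Gaifman graph: distinct vertices are adjacent when some tuple of some relation contains
both of them. -/
def gaifman : SimpleGraph A where
  Adj x y := x ≠ y ∧ ∃ (n : ℕ) (R : L.Relations n) (t : Fin n → A),
    FirstOrder.Language.Structure.RelMap R t ∧ x ∈ Set.range t ∧ y ∈ Set.range t
  symm := ⟨fun _ _ h => ⟨h.1.symm, by
    obtain ⟨_, n, R, t, ht, hx, hy⟩ := h
    exact ⟨n, R, t, ht, hy, hx⟩⟩⟩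
  loopless := ⟨fun _ h => h.1 rfl⟩

/-- A relational structure is connected when its Gaifman graph is connected. -/
def IsConnected : Prop :=
  (gaifman L A).Connected

/-- A cut: a set of vertices whose removal leaves the Gaifman graph disconnected, that is, with
two remaining vertices not joined by a path (so the empty set is a cut exactly when the structure
itself is disconnected in this sense). -/
def IsCut (C : Set A) : Prop :=
  ¬ ((gaifman L A).induce Cᶜ).Preconnected

/-- An inclusion-minimal cut. -/
def IsMinimalCut (C : Set A) : Prop :=
  IsCut L A C ∧ ∀ D : Set A, D ⊂ C → ¬ IsCut L A D

/-- A finite structure is a core when each of its endomorphisms is an automorphism. -/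
def IsCore : Prop :=
  ∀ f : A →[L] A, ∃ e : A ≃[L] A, ∀ x, e x = f x

end Basic

/-- The substructure induced on a set of vertices (in a relational language every set of vertices
carries an induced substructure). -/
def induced (L : FirstOrder.Language.{0, 0}) [L.IsRelational] {A : Type} [L.Structure A] (C : Set A) :
    L.Substructure A where
  carrier := C
  fun_mem := fun f => isEmptyElim f

/-- `A` is a homomorphic image of `B`: there is a homomorphism from `B` onto `A` such that the
tuples of `A` are exactly the images of the tuples of `B`. -/
def IsHomImage (L : FirstOrder.Language.{0, 0}) (B A : Type) [L.Structure B] [L.Structure A] : Prop :=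
  ∃ f : B →[L] A, Function.Surjective f ∧
    ∀ (n : ℕ) (R : L.Relations n) (t : Fin n → A), FirstOrder.Language.Structure.RelMap R t →
      ∃ s : Fin n → B, FirstOrder.Language.Structure.RelMap R s ∧ ∀ k, f (s k) = t k

section Families

variable (L : FirstOrder.Language.{0, 0}) {ι : Type} (F : ι → Type) [∀ j, L.Structure (F j)]

/-- No member of the family admits a homomorphism to `M`. -/
def Forb (M : Type) [L.Structure M] : Prop :=
  ∀ j, IsEmpty (F j →[L] M)

/-- A minimal family: all members are cores, with no homomorphism between different members. -/
def IsMinimalFamily : Prop :=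
  (∀ j, IsCore L (F j)) ∧ ∀ j k, j ≠ k → IsEmpty (F j →[L] F k)

/-- `U` is a universal structure of the class of countable structures in `Forb`: it belongs to the
class and every structure of the class embeds into it as an induced substructure. -/
def IsUniversal (U : Type) [L.Structure U] : Prop :=
  Countable U ∧ Forb L F U ∧
    ∀ (M : Type) [L.Structure M], Countable M → Forb L F M → Nonempty (M ↪[L] U)

/-- `A` is a minimal homomorphic image of the member `F j`: a homomorphic image of `F j` all of
whose proper substructures belong to `Forb`. -/
def IsMinimalHomImage (j : ι) (A : Type) [L.Structure A] : Prop :=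
  IsHomImage L (F j) A ∧ ∀ S : L.Substructure A, S ≠ ⊤ → Forb L F S

end Families

section Partitions

variable (L : FirstOrder.Language.{0, 0}) [L.IsRelational] (U : Type) [L.Structure U]

/-- Whenever the vertices are partitioned into `A` and `B` and some finite induced substructure has
no copy in `A`, there is a copy of the whole structure in `B`. -/
def IsWeaklyIndivisible : Prop :=
  ∀ A B : Set U, Disjoint A B → A ∪ B = Set.univ →
    (∃ S : Set U, S.Finite ∧ IsEmpty (induced L S ↪[L] induced L A)) →
      Nonempty (U ↪[L] induced L B)

/-- The vertices can be partitioned into two sets neither of which contains a copy of the whole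
structure. -/
def IsDivisible : Prop :=
  ∃ A B : Set U, Disjoint A B ∧ A ∪ B = Set.univ ∧
    IsEmpty (U ↪[L] induced L A) ∧ IsEmpty (U ↪[L] induced L B)

end Partitions

end WeakIndiv

namespace WeakIndiv

open FirstOrder.Language.Structure (RelMap)

/-! Divisibility: a cut vertex `c` splits the minimal image `A` into two proper substructures
sharing only `c`, and both embed in `U`. Let `X` be the set of images of `c` under homomorphisms
from the first piece. A copy of the second piece in `X` would combine with such a homomorphism to a
map from `A` to `U`; a copy of the first piece, hence of `U`, cannot lie outside `X`.

Weak indivisibility: `U` is an existentially closed countable structure avoiding the family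
(`exists_isEC`). Try to embed it in `B` vertex by vertex, keeping each finite stage compatible with
all partial homomorphisms from the family (`Transfers`) and free over a finite set (`PartialEmb`).
If this fails, there is a stuck partial embedding over every finite set; take one for each vertex of
the finite `S`, mutually free. Along each, glue to `U` a copy of `U` supplying the next vertex, and
impose `S` on these new points. If the result avoids the family, existential closedness realizes the
new points in `U` (`Gluing.exists_points`). They form a copy of `S`, so one lies in `B` and extends
its stuck embedding. Universality follows from the same extension step with a single block.

The crux is that the glued structure avoids the family (`Gluing.T_forb`). An image of a member using
no tuple of `S` folds back into `U` by `Transfers`. One with an edge between two new points consists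
of new points only (`false_of_adj_σ`) and so maps to `S`. Otherwise, connectedness of neighbourhoods
(`HasConnectedCuts.connIn_nbr`) attaches each outer component to a single glued set, and removing at
most one new point disconnects the image, although all its cuts have at least two vertices. -/

theorem preconnected_iff_closed {V : Type} (G : SimpleGraph V) :
    G.Preconnected ↔ ∀ Z : Set V, (∃ z, z ∈ Z) → (∀ x ∈ Z, ∀ y, G.Adj x y → y ∈ Z) →
      ∀ y, y ∈ Z := by
  constructor
  · rintro h Z ⟨z, hz⟩ hZ y
    obtain ⟨w⟩ := h z y
    induction w with
    | nil => exact hz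
    | cons hadj _ ih => exact ih (hZ _ hz _ hadj)
  · intro h x y
    exact h {y | G.Reachable x y} ⟨x, SimpleGraph.Reachable.refl x⟩
      (fun a ha b hab => SimpleGraph.Reachable.trans ha hab.reachable) y

/-! ### Cuts as closed sets of vertices, and divisibility from a cut vertex. -/

section

variable {L : FirstOrder.Language.{0, 0}}

theorem isCut_iff {A : Type} [L.Structure A] (C : Set A) :
    IsCut L A C ↔ ∃ Z : Set A, (∃ z, z ∈ Z) ∧ (∀ z ∈ Z, z ∉ C) ∧ (∃ w, w ∉ C ∧ w ∉ Z) ∧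
      ∀ x ∈ Z, ∀ y, y ∉ C → (gaifman L A).Adj x y → y ∈ Z := by
  unfold IsCut
  rw [preconnected_iff_closed]
  constructor
  · intro h
    push Not at h
    obtain ⟨Z, ⟨z, hz⟩, hZ, w, hw⟩ := h
    refine ⟨Subtype.val '' Z, ⟨z, z, hz, rfl⟩, ?_, ⟨w, w.2, ?_⟩, ?_⟩
    · rintro _ ⟨a, _, rfl⟩
      exact a.2
    · rintro ⟨a, ha, hae⟩
      exact hw (Subtype.ext hae ▸ ha)
    · rintro _ ⟨a, ha, rfl⟩ y hy hadj
      exact ⟨⟨y, hy⟩, hZ a ha ⟨y, hy⟩ hadj, rfl⟩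
  · rintro ⟨Z, ⟨z, hz⟩, hZC, ⟨w, hwC, hw⟩, hZ⟩ h
    exact hw (h {a | a.1 ∈ Z} ⟨⟨z, hZC z hz⟩, hz⟩
      (fun x hx y hxy => hZ x.1 hx y.1 y.2 hxy) ⟨w, hwC⟩)

variable [L.IsRelational]

/-- A relation-preserving function between relational structures, as a homomorphism. -/
def homOf {A B : Type} [L.Structure A] [L.Structure B] (f : A → B)
    (h : ∀ (n : ℕ) (R : L.Relations n) (t : Fin n → A), RelMap R t → RelMap R (f ∘ t)) :
    A →[L] B where
  toFun := f
  map_fun' := fun g => isEmptyElim g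
  map_rel' := fun R t => h _ R t

/-- An injective function preserving and reflecting relations, as an embedding. -/
def embOf {A B : Type} [L.Structure A] [L.Structure B] (f : A → B) (hf : Function.Injective f)
    (h : ∀ (n : ℕ) (R : L.Relations n) (t : Fin n → A), RelMap R t ↔ RelMap R (f ∘ t)) :
    A ↪[L] B where
  toFun := f
  inj' := hf
  map_fun' := fun g => isEmptyElim g
  map_rel' := fun R t => (h _ R t).symm

/-- Two homomorphisms from the two sides of a cut vertex which agree there can be combined. -/
theorem exists_hom_of_cut {A U : Type} [L.Structure A] [L.Structure U] {c : A} {Z : Set A}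
    (hcZ : c ∉ Z) (hZ : ∀ x ∈ Z, ∀ y, y ≠ c → (gaifman L A).Adj x y → y ∈ Z)
    (f₁ : induced L (insert c Z) →[L] U) (f₂ : induced L Zᶜ →[L] U)
    (h : f₁ ⟨c, Set.mem_insert c Z⟩ = f₂ ⟨c, hcZ⟩) : Nonempty (A →[L] U) := by
  classical
  refine ⟨homOf (fun a => if ha : a ∈ Z then f₁ ⟨a, Set.mem_insert_of_mem c ha⟩
    else f₂ ⟨a, ha⟩) ?_⟩
  intro n R t ht
  by_cases hk : ∃ k, t k ∈ Z
  · obtain ⟨k, hk⟩ := hk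
    have hall : ∀ l, t l ∈ insert c Z := by
      intro l
      by_cases hl : t l = c
      · exact Or.inl hl
      by_cases hkl : t l = t k
      · exact Or.inr (hkl ▸ hk)
      · exact Or.inr (hZ _ hk _ hl ⟨fun e => hkl e.symm, n, R, t, ht, ⟨k, rfl⟩, ⟨l, rfl⟩⟩)
    have := f₁.map_rel R (fun l => ⟨t l, hall l⟩) ht
    convert this using 1
    funext l
    simp only [Function.comp]
    split_ifs with hl
    · rfl
    · have hlc : t l = c := (hall l).resolve_right hl
      have e1 : (⟨t l, hl⟩ : induced L Zᶜ) = ⟨c, hcZ⟩ := Subtype.ext hlc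
      have e2 : (⟨t l, hall l⟩ : induced L (insert c Z)) = ⟨c, Set.mem_insert c Z⟩ :=
        Subtype.ext hlc
      rw [e1, ← h]
      exact congrArg f₁ e2.symm
  · push Not at hk
    have := f₂.map_rel R (fun l => ⟨t l, hk l⟩) ht
    convert this using 1
    funext l
    simp [hk l]

theorem isDivisible_of_isCut_singleton {ι : Type} (F : ι → Type) [∀ j, L.Structure (F j)]
    [∀ j, Finite (F j)] {j : ι} {A : Type} [L.Structure A] (hA : IsMinimalHomImage L F j A)
    {c : A} (hc : IsCut L A {c}) {U : Type} [L.Structure U] (hU : IsUniversal L F U) :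
    IsDivisible L U ∧ ¬ IsWeaklyIndivisible L U := by
  obtain ⟨⟨p, hp, -⟩, hmin⟩ := hA
  obtain ⟨-, hUF, huniv⟩ := hU
  obtain ⟨Z, ⟨z, hz⟩, hZc, ⟨w, hwc, hw⟩, hZ⟩ := (isCut_iff {c}).1 hc
  have hfin : Finite A := Finite.of_surjective p hp
  have hcZ : c ∉ Z := fun h => hZc c h rfl
  have h1 : induced L (insert c Z) ≠ ⊤ := by
    intro h
    have : w ∈ induced L (insert c Z) := h ▸ trivial
    rcases this with h | h
    exacts [hwc h, hw h]
  have h2 : induced L Zᶜ ≠ ⊤ := by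
    intro h
    have : z ∈ induced L Zᶜ := h ▸ trivial
    exact this hz
  obtain ⟨e₁⟩ := huniv (induced L (insert c Z)) inferInstance (hmin _ h1)
  obtain ⟨e₂⟩ := huniv (induced L Zᶜ) inferInstance (hmin _ h2)
  let c₁ : induced L (insert c Z) := ⟨c, Set.mem_insert c Z⟩
  let c₂ : induced L Zᶜ := ⟨c, hcZ⟩
  -- All positions in `U` that a homomorphism of the first piece can give to the cut vertex.
  let X : Set U := {v | ∃ f : induced L (insert c Z) →[L] U, f c₁ = v}
  have hX : IsEmpty (induced L Zᶜ ↪[L] induced L X) := by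
    refine ⟨fun g => ?_⟩
    obtain ⟨f, hf⟩ := (g c₂).2
    let f₂ : induced L Zᶜ →[L] U := (((induced L X).subtype).comp g).toHom
    obtain ⟨k⟩ := exists_hom_of_cut hcZ hZ f f₂ hf
    exact (hUF j).false (k.comp p)
  have hY : IsEmpty (U ↪[L] induced L Xᶜ) := by
    refine ⟨fun g => ?_⟩
    exact (g (e₁ c₁)).2 ⟨(((induced L Xᶜ).subtype).comp (g.comp e₁)).toHom, rfl⟩
  have hdis : Disjoint X Xᶜ := disjoint_compl_right
  have hun : X ∪ Xᶜ = Set.univ := Set.union_compl_self X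
  refine ⟨⟨X, Xᶜ, hdis, hun, ⟨fun g => hX.false (g.comp e₂)⟩, hY⟩, fun h => ?_⟩
  have hS : IsEmpty (induced L (Set.range e₂) ↪[L] induced L X) := by
    refine ⟨fun g => hX.false (g.comp (embOf (fun a => ⟨e₂ a, ⟨a, rfl⟩⟩) ?_ ?_))⟩
    · intro a b hab
      exact e₂.injective (congrArg Subtype.val hab)
    · intro n R t
      exact (e₂.map_rel R t).symm
  obtain ⟨g⟩ := h X Xᶜ hdis hun ⟨Set.range e₂, Set.finite_range e₂, hS⟩
  exact hY.false g

end

/-! ### Connected neighbourhoods in homomorphic images. -/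

section

variable {L : FirstOrder.Language.{0, 0}}

/-- `E` is connected in the Gaifman graph: a nonempty subset closed under adjacency in `E` is
everything. -/
def ConnSet (L : FirstOrder.Language.{0, 0}) {A : Type} [L.Structure A] (E : Set A) : Prop :=
  ∀ Z ⊆ E, (∃ z, z ∈ Z) → (∀ x ∈ Z, ∀ y ∈ E, (gaifman L A).Adj x y → y ∈ Z) → E ⊆ Z

/-- The outer neighbourhood of a set of vertices. -/
def nbr (L : FirstOrder.Language.{0, 0}) {A : Type} [L.Structure A] (E : Set A) : Set A :=
  {y | y ∉ E ∧ ∃ x ∈ E, (gaifman L A).Adj x y}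

/-- The structure induced on `C` is preconnected, in terms of closed sets. -/
def ConnIn (L : FirstOrder.Language.{0, 0}) {A : Type} [L.Structure A] (C : Set A) : Prop :=
  ∀ Z : Set A, (∃ z ∈ Z, z ∈ C) →
    (∀ (n : ℕ) (R : L.Relations n) (t : Fin n → A), RelMap R t → (∀ k, t k ∈ C) →
      ∀ k l, t k ∈ Z → t l ∈ Z) → C ⊆ Z

/-- Every minimal cut of every homomorphic image of a member of the family has at least two
vertices and induces a connected structure. -/
def HasConnectedCuts (L : FirstOrder.Language.{0, 0}) {ι : Type} (F : ι → Type)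
    [∀ j, L.Structure (F j)] : Prop :=
  ∀ (j : ι) (A : Type) [L.Structure A], IsHomImage L (F j) A →
    ∀ C : Set A, IsMinimalCut L A C → 2 ≤ C.ncard ∧ ConnIn L C

theorem adj_of_relMap {A : Type} [L.Structure A] {n : ℕ} {R : L.Relations n} {t : Fin n → A}
    (ht : RelMap R t) {k l : Fin n} (h : t k ≠ t l) : (gaifman L A).Adj (t k) (t l) :=
  ⟨h, n, R, t, ht, ⟨k, rfl⟩, ⟨l, rfl⟩⟩

theorem IsConnected.connIn [L.IsRelational] {A : Type} [L.Structure A] {C : Set A}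
    (h : IsConnected L (induced L C)) : ConnIn L C := by
  rintro Z ⟨z, hz, hzC⟩ hZ y hy
  have := (preconnected_iff_closed _).1 h.preconnected {a | a.1 ∈ Z} ⟨⟨z, hzC⟩, hz⟩ ?_ ⟨y, hy⟩
  · exact this
  · rintro x hx y ⟨-, n, R, t, ht, ⟨k, rfl⟩, ⟨l, rfl⟩⟩
    exact hZ n R (fun i => (t i).1) ht (fun i => (t i).2) k l hx

theorem IsCut.exists_isMinimalCut {A : Type} [L.Structure A] [Finite A] {T : Set A}
    (h : IsCut L A T) : ∃ C ⊆ T, IsMinimalCut L A C := by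
  obtain ⟨C, hCT, hC⟩ := exists_minimal_le_of_wellFoundedLT (IsCut L A) T h
  exact ⟨C, hCT, hC.prop, fun D hD => hC.not_prop_of_lt hD⟩

theorem IsHomImage.trans {A B D : Type} [L.Structure A] [L.Structure B] [L.Structure D]
    (h : IsHomImage L A B) (h' : IsHomImage L B D) : IsHomImage L A D := by
  obtain ⟨f, hf, hfr⟩ := h
  obtain ⟨g, hg, hgr⟩ := h'
  refine ⟨g.comp f, hg.comp hf, fun n R t ht => ?_⟩
  obtain ⟨s, hs, e⟩ := hgr n R t ht
  obtain ⟨r, hr, e'⟩ := hfr n R s hs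
  exact ⟨r, hr, fun k => by rw [← e k, ← e' k]; rfl⟩

theorem IsHomImage.finite {A B : Type} [L.Structure A] [L.Structure B] [Finite A]
    (h : IsHomImage L A B) : Finite B := by
  obtain ⟨f, hf, -⟩ := h
  exact Finite.of_surjective f hf

/-- Homomorphic images of members of a family with connected cuts stay connected after the removal
of at most one vertex. -/
theorem HasConnectedCuts.not_isCut {ι : Type} {F : ι → Type} [∀ j, L.Structure (F j)]
    (hF : HasConnectedCuts L F) {j : ι} [Finite (F j)] {A : Type} [L.Structure A]
    (hA : IsHomImage L (F j) A) {C : Set A} (hC : C.Subsingleton) : ¬ IsCut L A C := by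
  intro h
  have := hA.finite
  obtain ⟨D, hDC, hD⟩ := h.exists_isMinimalCut
  have h1 := (hF j A hA D hD).1
  have h2 := Set.ncard_le_one_iff_subsingleton.2 (hC.anti hDC)
  omega

variable [L.IsRelational]

/-- The structure on the target of a map whose tuples are the images of tuples of the source. -/
@[reducible] def imageStructure {A B : Type} [L.Structure A] (f : A → B) : L.Structure B where
  funMap := fun g => isEmptyElim g
  RelMap := fun R t => ∃ s, RelMap R s ∧ f ∘ s = t

theorem isHomImage_imageStructure {A B : Type} [L.Structure A] (f : A → B)
    (hf : Function.Surjective f) : @IsHomImage L A B _ (imageStructure f) := by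
  let := imageStructure (L := L) f
  exact ⟨homOf f (fun n R t ht => ⟨t, ht, rfl⟩), hf,
    fun n R t ⟨s, hs, e⟩ => ⟨s, hs, fun k => congrFun e k⟩⟩

section Collapse

variable {A : Type} [L.Structure A] {Z C : Set A} {c : A}

open Classical in
/-- Collapse the set `Z` to the point `c` outside it. -/
noncomputable def collapse (hc : c ∉ Z) (a : A) : {a : A // a ∉ Z} :=
  if h : a ∈ Z then ⟨c, hc⟩ else ⟨a, h⟩

theorem collapse_of_mem (hc : c ∉ Z) {a : A} (h : a ∈ Z) : collapse hc a = ⟨c, hc⟩ :=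
  dif_pos h

theorem collapse_of_notMem (hc : c ∉ Z) {a : A} (h : a ∉ Z) : collapse hc a = ⟨a, h⟩ :=
  dif_neg h

theorem collapse_surjective (hc : c ∉ Z) : Function.Surjective (collapse hc) :=
  fun a => ⟨a.1, collapse_of_notMem hc a.2⟩

/-- If the neighbours of `Z` are in `C`, then a tuple of the collapsed structure with a vertex
outside `C` is a tuple of the original structure. -/
theorem relMap_of_collapse (hc : c ∉ Z) (hcC : c ∈ C)
    (hZ : ∀ x ∈ Z, ∀ y, y ∉ C → (gaifman L A).Adj x y → y ∈ Z)
    {n : ℕ} {R : L.Relations n} {t : Fin n → {a : A // a ∉ Z}}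
    (ht : @RelMap L _ (imageStructure (collapse hc)) n R t) :
    RelMap R (fun k => (t k).1) ∨ ∀ k, (t k).1 ∈ C := by
  obtain ⟨s, hs, rfl⟩ := ht
  by_cases h : ∃ k, s k ∈ Z
  · right
    obtain ⟨k, hk⟩ := h
    intro l
    by_cases hl : s l ∈ Z
    · simpa [collapse_of_mem hc hl] using hcC
    · by_contra hlC
      have hlC' : s l ∉ C := by simpa [collapse_of_notMem hc hl] using hlC
      exact hl (hZ _ hk _ hlC' (adj_of_relMap hs (fun e => hl (e ▸ hk))))
  · left
    push Not at h
    convert hs using 1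
    funext k
    simp [collapse_of_notMem hc (h k)]

theorem relMap_collapse_of_relMap (hc : c ∉ Z)
    {n : ℕ} {R : L.Relations n} {t : Fin n → A} (ht : RelMap R t) (h : ∀ k, t k ∉ Z) :
    @RelMap L _ (imageStructure (collapse hc)) n R (fun k => ⟨t k, h k⟩) :=
  ⟨t, ht, funext fun k => collapse_of_notMem hc (h k)⟩

/-- Collapsing alters only tuples meeting `Z`, and their vertices outside `Z` lie in `C`. A tuple
through a surviving vertex outside `C` is therefore untouched. -/
theorem adj_collapse_iff (hc : c ∉ Z) (hcC : c ∈ C)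
    (hZ : ∀ x ∈ Z, ∀ y, y ∉ C → (gaifman L A).Adj x y → y ∈ Z)
    {x y : {a : A // a ∉ Z}} (hx : x.1 ∉ C) :
    (@gaifman L _ (imageStructure (collapse hc))).Adj x y ↔ (gaifman L A).Adj x.1 y.1 := by
  let := imageStructure (L := L) (collapse hc)
  constructor
  · rintro ⟨hne, n, R, t, ht, ⟨k, rfl⟩, ⟨l, rfl⟩⟩
    rcases relMap_of_collapse hc hcC hZ ht with h | h
    · exact adj_of_relMap h (fun e => hne (Subtype.ext e))
    · exact absurd (h k) hx
  · rintro ⟨hne, n, R, t, ht, ⟨k, hk⟩, ⟨l, hl⟩⟩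
    have hall : ∀ i, t i ∉ Z := by
      intro i hi
      refine x.2 (hZ _ hi _ hx ?_)
      rw [← hk]
      refine adj_of_relMap ht (fun e => x.2 ?_)
      rw [← hk, ← e]
      exact hi
    exact ⟨fun e => hne (congrArg _ e), n, R, _, relMap_collapse_of_relMap hc ht hall,
      ⟨k, Subtype.ext hk⟩, ⟨l, Subtype.ext hl⟩⟩

theorem nbr_collapse (hc : c ∉ Z) (hcC : c ∈ C)
    (hZ : ∀ x ∈ Z, ∀ y, y ∉ C → (gaifman L A).Adj x y → y ∈ Z) {E : Set A}
    (hEC : ∀ x ∈ E, x ∉ C) (hEZ : ∀ x ∈ E, x ∉ Z) :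
    @nbr L _ (imageStructure (collapse hc)) {a | a.1 ∈ E} = {a | a.1 ∈ nbr L E} := by
  ext y
  constructor
  · rintro ⟨hy, x, hx, hxy⟩
    exact ⟨hy, x.1, hx, (adj_collapse_iff hc hcC hZ (hEC _ hx)).1 hxy⟩
  · rintro ⟨hy, x, hx, hxy⟩
    exact ⟨hy, ⟨x, hEZ x hx⟩, hx,
      (adj_collapse_iff hc hcC hZ (x := ⟨x, hEZ x hx⟩) (hEC _ hx)).2 hxy⟩

theorem ConnSet.collapse (hc : c ∉ Z) (hcC : c ∈ C)
    (hZ : ∀ x ∈ Z, ∀ y, y ∉ C → (gaifman L A).Adj x y → y ∈ Z) {E : Set A}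
    (hEC : ∀ x ∈ E, x ∉ C) (hEZ : ∀ x ∈ E, x ∉ Z) (hE : ConnSet L E) :
    @ConnSet L _ (imageStructure (collapse hc)) {a | a.1 ∈ E} := by
  rintro Y hY ⟨y, hy⟩ hYc a ha
  have := hE (Subtype.val '' Y) (by rintro _ ⟨b, hb, rfl⟩; exact hY hb) ⟨y.1, y, hy, rfl⟩ ?_ ha
  · obtain ⟨b, hb, e⟩ := this
    rwa [← Subtype.ext e]
  · rintro _ ⟨b, hb, rfl⟩ d hd hbd
    exact ⟨⟨d, hEZ d hd⟩, hYc b hb _ hd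
      ((adj_collapse_iff hc hcC hZ (hEC _ (hY hb))).2 hbd), rfl⟩

end Collapse

/-- The neighbourhood of a connected set `E` induces a connected structure, provided it is
contained in the neighbourhood of a second connected set away from `E`. -/
theorem HasConnectedCuts.connIn_nbr {ι : Type} {F : ι → Type} [∀ j, L.Structure (F j)]
    (hF : HasConnectedCuts L F) {j : ι} [Finite (F j)] : ∀ (N : ℕ) (A : Type) [L.Structure A],
    IsHomImage L (F j) A → Nat.card A = N → ∀ E D : Set A, (∃ e, e ∈ E) → (∃ d, d ∈ D) →
      ConnSet L E → ConnSet L D → (∀ d ∈ D, d ∉ E) → (∀ d ∈ D, d ∉ nbr L E) →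
      nbr L E ⊆ nbr L D → ConnIn L (nbr L E) := by
  intro N
  induction N using Nat.strong_induction_on with
  | _ N ih =>
  rintro A _ hA rfl E D ⟨e, he⟩ ⟨d, hd⟩ hE hD hDE hDT hTD
  have := hA.finite
  have hET : ∀ x ∈ E, x ∉ nbr L E := fun x hx h => h.1 hx
  have hcut : IsCut L A (nbr L E) := by
    refine (isCut_iff _).2 ⟨E, ⟨e, he⟩, hET, ⟨d, hDT d hd, hDE d hd⟩, fun x hx y hy hxy => ?_⟩
    by_contra hyE
    exact hy ⟨hyE, x, hx, hxy⟩
  -- `nbr L E` need not be an inclusion-minimal cut. If `C` is strictly smaller, a remaining vertex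
  -- `t`, adjacent to both `E` and `D`, keeps them on its own side of `C`; another side `Z` is
  -- collapsed onto a vertex of `C`, and induction applies to the smaller image.
  obtain ⟨C, hCT, hCmin⟩ := hcut.exists_isMinimalCut
  obtain ⟨hC2, hCc⟩ := hF j A hA C hCmin
  by_cases hTC : nbr L E ⊆ C
  · rwa [← Set.Subset.antisymm hCT hTC]
  obtain ⟨t, htT, htC⟩ := Set.not_subset.1 hTC
  obtain ⟨Z, ⟨z, hz⟩, hZC, hZ, htZ⟩ : ∃ Z : Set A, (∃ z, z ∈ Z) ∧ (∀ z ∈ Z, z ∉ C) ∧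
      (∀ x ∈ Z, ∀ y, y ∉ C → (gaifman L A).Adj x y → y ∈ Z) ∧ t ∉ Z := by
    obtain ⟨Z, hz, hZC, ⟨w, hwC, hw⟩, hZ⟩ := (isCut_iff C).1 hCmin.1
    by_cases ht : t ∈ Z
    · refine ⟨{y | y ∉ C ∧ y ∉ Z}, ⟨w, hwC, hw⟩, fun z hz => hz.1, ?_, fun h => h.2 ht⟩
      exact fun x hx y hy hxy => ⟨hy, fun hyZ => hx.2 (hZ y hyZ x hx.1 hxy.symm)⟩
    · exact ⟨Z, hz, hZC, hZ, ht⟩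
  have avoid : ∀ G : Set A, ConnSet L G → (∀ x ∈ G, x ∉ C) → t ∈ nbr L G → ∀ x ∈ G, x ∉ Z := by
    rintro G hG hGC ⟨-, x, hx, hxt⟩ y hy hyZ
    have : G ⊆ {y | y ∈ G ∧ y ∈ Z} := hG _ (fun y h => h.1) ⟨y, hy, hyZ⟩
      (fun a ha b hb hab => ⟨hb, hZ a ha.2 b (hGC b hb) hab⟩)
    exact htZ (hZ x (this hx).2 t htC hxt)
  have hEC : ∀ x ∈ E, x ∉ C := fun x hx h => hET x hx (hCT h)
  have hDC : ∀ x ∈ D, x ∉ C := fun x hx h => hDT x hx (hCT h)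
  have hEZ := avoid E hE hEC htT
  have hDZ := avoid D hD hDC (hTD htT)
  have hTZ : ∀ x ∈ nbr L E, x ∉ Z := by
    rintro x ⟨-, y, hy, hyx⟩ hxZ
    exact hEZ y hy (hZ x hxZ y (hEC y hy) hyx.symm)
  obtain ⟨c, hcC⟩ : C.Nonempty := Set.nonempty_of_ncard_ne_zero (by omega)
  have hc : c ∉ Z := fun h => hZC c h hcC
  let := imageStructure (L := L) (collapse hc)
  have key := ih (Nat.card {a : A // a ∉ Z})
    (Finite.card_subtype_lt (p := fun a => a ∉ Z) (not_not.2 hz)) {a : A // a ∉ Z}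
    (hA.trans (isHomImage_imageStructure _ (collapse_surjective hc))) rfl
    {a | a.1 ∈ E} {a | a.1 ∈ D} ⟨⟨e, hEZ e he⟩, he⟩ ⟨⟨d, hDZ d hd⟩, hd⟩
    (hE.collapse hc hcC hZ hEC hEZ) (hD.collapse hc hcC hZ hDC hDZ)
    (fun a ha => hDE _ ha)
  rw [nbr_collapse hc hcC hZ hEC hEZ, nbr_collapse hc hcC hZ hDC hDZ] at key
  have key := key (fun a ha => hDT _ ha) (fun a ha => hTD ha)
  -- Tuples created by the collapse lie inside `C`, which is already connected in `A`, so a closed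
  -- set stays closed.
  rintro Y ⟨y, hyY, hyT⟩ hY x hx
  refine key {a | a.1 ∈ Y} ⟨⟨y, hTZ y hyT⟩, hyY, hyT⟩ ?_ (a := ⟨x, hTZ x hx⟩) hx
  intro n R s hs hsT k l hk
  rcases relMap_of_collapse hc hcC hZ hs with h | h
  · exact hY n R _ h hsT k l hk
  · exact hCc Y ⟨_, hk, h k⟩
      (fun n R t ht htC => hY n R t ht (fun i => hCT (htC i))) (h l)

end

/-! ### A generic construction of existentially closed structures. -/

section

/-- The relations of a relational structure with vertex set `V`, unbundled. -/
abbrev Rels (L : FirstOrder.Language.{0, 0}) (V : Type) : Type :=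
  ∀ n : ℕ, L.Relations n → (Fin n → V) → Prop

variable {L : FirstOrder.Language.{0, 0}} {ι : Type} {F : ι → Type} [∀ j, L.Structure (F j)]

/-- No member of the family has a homomorphism to the structure with relations `S`. -/
def RForb (F : ι → Type) [∀ j, L.Structure (F j)] {V : Type} (S : Rels L V) : Prop :=
  ∀ (j : ι) (f : F j → V), ¬ ∀ (n : ℕ) (R : L.Relations n) (t : Fin n → F j),
    RelMap R t → S n R (f ∘ t)

/-- Every vertex of every member of the family lies in some tuple. -/
def IsCovered (L : FirstOrder.Language.{0, 0}) (F : ι → Type) [∀ j, L.Structure (F j)] : Prop :=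
  ∀ (j : ι) (q : F j), ∃ (n : ℕ) (R : L.Relations n) (t : Fin n → F j), RelMap R t ∧ ∃ k, t k = q

theorem RForb.comap {V W : Type} {S : Rels L V} {T : Rels L W} (hT : RForb F T) (f : V → W)
    (h : ∀ n R t, S n R t → T n R (f ∘ t)) : RForb F S :=
  fun j g hg => hT j (f ∘ g) (fun n R t ht => h n R (g ∘ t) (hg n R t ht))

/-- Isolated vertices do not matter: only the vertices lying in tuples have to be covered. -/
theorem RForb.of_exists_lift {V W : Type} [Nonempty V] {S : Rels L V}
    {T : Rels L W} (hS : RForb F S) (b : V → W) (hb : Function.Injective b)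
    (h : ∀ n R t, T n R t → ∃ s, S n R s ∧ b ∘ s = t) : RForb F T := by
  intro j f hf
  refine hS j (Function.invFun b ∘ f) (fun n R t ht => ?_)
  obtain ⟨s, hs, e⟩ := h n R _ (hf n R t ht)
  rw [Function.comp_assoc, ← e, ← Function.comp_assoc, Function.invFun_comp hb]
  exact hs

/-- `U` is existentially closed among the countable structures avoiding the family. -/
def IsEC (F : ι → Type) [∀ j, L.Structure (F j)] (U : Rels L ℕ) : Prop :=
  ∀ (V : Type) [Countable V] (T : Rels L V), RForb F T → ∀ i : ℕ → V, Function.Injective i →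
    (∀ n R t, U n R t ↔ T n R (i ∘ t)) → ∀ M : Set V, M.Finite →
      ∃ e : V → ℕ, Set.InjOn e M ∧
        (∀ n R t, (∀ k, t k ∈ M) → (T n R t ↔ U n R (e ∘ t))) ∧ ∀ u, i u ∈ M → e (i u) = u

/-- Tuples of natural numbers labelled by relation symbols. -/
abbrev Tup (L : FirstOrder.Language.{0, 0}) : Type :=
  Σ r : (Σ n, L.Relations n), Fin r.1 → ℕ

/-- The relations given by a set of labelled tuples. -/
def tupRel (D : Finset (Tup L)) : Rels L ℕ := fun n R t => (⟨⟨n, R⟩, t⟩ : Tup L) ∈ D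

/-- A finite structure on an initial segment of the natural numbers, avoiding the family. -/
structure Cond (F : ι → Type) [∀ j, L.Structure (F j)] where
  bd : ℕ
  tup : Finset (Tup L)
  lt_bd : ∀ n R t, tupRel tup n R t → ∀ k, t k < bd
  forb : RForb F (tupRel tup)

/-- The finite structure `q` extends the finite structure `p`. -/
def Cond.Ext (p q : Cond (L := L) F) : Prop :=
  p.bd ≤ q.bd ∧ ∀ n R t, (∀ k, t k < p.bd) → (tupRel q.tup n R t ↔ tupRel p.tup n R t)

theorem Cond.Ext.refl (p : Cond (L := L) F) : p.Ext p := ⟨le_rfl, fun _ _ _ _ => Iff.rfl⟩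

theorem Cond.Ext.trans {p q r : Cond (L := L) F} (h : p.Ext q) (h' : q.Ext r) : p.Ext r :=
  ⟨h.1.trans h'.1, fun n R t ht =>
    (h'.2 n R t (fun k => (ht k).trans_le h.1)).trans (h.2 n R t ht)⟩

/-- An extension task: embed the structure with vertex set `dom` and tuples `tup`, fixing the
vertices below `fix`. -/
structure Task (L : FirstOrder.Language.{0, 0}) where
  fix : ℕ
  dom : Finset ℕ
  tup : Finset (Tup L)

instance [Finite (Σ n, L.Relations n)] : Countable (Task L) := by
  refine Function.Injective.countable (β := ℕ × Finset ℕ × Finset (Tup L))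
    (f := fun τ => (τ.fix, τ.dom, τ.tup)) ?_
  rintro ⟨a, b, c⟩ ⟨a', b', c'⟩ h
  simp only [Prod.mk.injEq] at h
  obtain ⟨rfl, rfl, rfl⟩ := h
  rfl

/-- The finite structure `p` realizes the extension task. -/
def Cond.Realizes (p : Cond (L := L) F) (τ : Task L) : Prop :=
  ∃ e : ℕ → ℕ, Set.InjOn e τ.dom ∧ (∀ u ∈ τ.dom, e u < p.bd) ∧
    (∀ u ∈ τ.dom, u < τ.fix → e u = u) ∧
    ∀ n R t, (∀ k, t k ∈ τ.dom) → (tupRel τ.tup n R t ↔ tupRel p.tup n R (e ∘ t))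

/-- Either some extension realizes the task, or none ever will. The bound is first pushed beyond
`p.bd` and `τ.fix`, so that the stages exhaust `ℕ` and all fixed vertices are present. -/
theorem Cond.exists_decides (τ : Task L) (p : Cond (L := L) F) :
    ∃ q : Cond (L := L) F, p.Ext q ∧ p.bd < q.bd ∧ τ.fix ≤ q.bd ∧
      (q.Realizes τ ∨ ∀ r : Cond (L := L) F, q.Ext r → ¬ r.Realizes τ) := by
  let q : Cond (L := L) F :=
    ⟨max p.bd τ.fix + 1, p.tup, fun n R t ht k => by have := p.lt_bd n R t ht k; omega, p.forb⟩
  have hpq : p.Ext q := ⟨by simp only [q]; omega, fun _ _ _ _ => Iff.rfl⟩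
  by_cases h : ∃ r : Cond (L := L) F, q.Ext r ∧ r.Realizes τ
  · obtain ⟨r, hr, hrτ⟩ := h
    have := hr.1
    exact ⟨r, hpq.trans hr, by simp only [q] at this; omega, by simp only [q] at this; omega,
      Or.inl hrτ⟩
  · push Not at h
    exact ⟨q, hpq, by simp only [q]; omega, by simp only [q]; omega, Or.inr h⟩

/-- The tuples of a finite part of a structure, transported to the natural numbers. -/
theorem exists_trace [Finite (Σ n, L.Relations n)] {V : Type} (T : Rels L V) (b : V → ℕ)
    {M : Set V} (hM : M.Finite) : ∃ D : Finset (Tup L), ∀ n R t,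
      tupRel D n R t ↔ ∃ s : Fin n → V, (∀ k, s k ∈ M) ∧ b ∘ s = t ∧ T n R s := by
  have := hM.to_subtype
  have hfin : {x : Tup L | ∃ s : Fin x.1.1 → V, (∀ k, s k ∈ M) ∧ b ∘ s = x.2 ∧
      T x.1.1 x.1.2 s}.Finite := by
    refine (Set.finite_range (fun x : Σ r : (Σ n, L.Relations n), (Fin r.1 → M) =>
      (⟨x.1, fun k => b (x.2 k)⟩ : Tup L))).subset ?_
    rintro ⟨r, t⟩ ⟨s, hs, e, -⟩
    exact ⟨⟨r, fun k => ⟨s k, hs k⟩⟩, congrArg (Sigma.mk r) e⟩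
  exact ⟨hfin.toFinset, fun n R t => by simp [tupRel]⟩

theorem exists_trace_of_injective [Finite (Σ n, L.Relations n)] {V : Type} (T : Rels L V)
    {b : V → ℕ} (hb : Function.Injective b) {M : Set V} (hM : M.Finite) :
    ∃ D : Finset (Tup L), (∀ n R (s : Fin n → V), (∀ k, s k ∈ M) →
      (tupRel D n R (b ∘ s) ↔ T n R s)) ∧
      ∀ n R t, tupRel D n R t → ∃ s : Fin n → V, (∀ k, s k ∈ M) ∧ T n R s ∧ b ∘ s = t := by
  obtain ⟨D, hD⟩ := exists_trace T b hM
  refine ⟨D, fun n R s hs => ⟨fun h => ?_, fun h => (hD n R _).2 ⟨s, hs, rfl, h⟩⟩,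
    fun n R t h => ?_⟩
  · obtain ⟨s', -, e, h'⟩ := (hD n R _).1 h
    rwa [← hb.comp_left e]
  · obtain ⟨s, h1, h2, h3⟩ := (hD n R t).1 h
    exact ⟨s, h1, h3, h2⟩

/-- There is an existentially closed countable structure avoiding the family. -/
theorem exists_isEC [Finite (Σ n, L.Relations n)] [∀ j, Finite (F j)] [∀ j, Nonempty (F j)]
    (hc : IsCovered L F) : ∃ U : Rels L ℕ, RForb F U ∧ IsEC F U := by
  classical
  choose next hext hlt hfix hdec using Cond.exists_decides (L := L) (F := F)
  have : Nonempty (Task L) := ⟨⟨0, ∅, ∅⟩⟩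
  obtain ⟨task, htask⟩ := exists_surjective_nat (Task L)
  -- The empty structure is admissible because every member contains a tuple.
  let p₀ : Cond (L := L) F := ⟨0, ∅, fun n R t h => absurd h (Finset.notMem_empty _),
    fun j f h => by
      obtain ⟨n, R, t, ht, -⟩ := hc j (Classical.arbitrary _)
      exact Finset.notMem_empty _ (h n R t ht)⟩
  let p : ℕ → Cond (L := L) F := fun m => Nat.rec p₀ (fun m q => next (task m) q) m
  have hp : ∀ m, p (m + 1) = next (task m) (p m) := fun m => rfl
  have hmono : ∀ m m', m ≤ m' → (p m).Ext (p m') := by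
    intro m m' h
    induction m', h using Nat.le_induction with
    | base => exact Cond.Ext.refl _
    | succ m' _ ih => exact ih.trans (hp m' ▸ hext _ _)
  have hbd : ∀ m, m ≤ (p m).bd := by
    intro m
    induction m with
    | zero => exact Nat.zero_le _
    | succ m ih => rw [hp]; exact Nat.succ_le_of_lt (ih.trans_lt (hlt _ _))
  let U : Rels L ℕ := fun n R t => ∃ m, tupRel (p m).tup n R t
  have hU : ∀ m n R t, (∀ k, t k < (p m).bd) → (U n R t ↔ tupRel (p m).tup n R t) := by
    intro m n R t ht
    refine ⟨?_, fun h => ⟨m, h⟩⟩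
    rintro ⟨m', hm'⟩
    rcases le_total m m' with h | h
    · exact ((hmono m m' h).2 n R t ht).1 hm'
    · exact ((hmono m' m h).2 n R t ((p m').lt_bd n R t hm')).2 hm'
  refine ⟨U, ?_, ?_⟩
  · intro j f hf
    obtain ⟨m, hm⟩ := (Set.finite_range f).bddAbove
    refine (p (m + 1)).forb j f (fun n R t ht => (hU (m + 1) n R _ (fun k => ?_)).1 (hf n R t ht))
    exact (Nat.lt_succ_of_le (hm ⟨t k, rfl⟩)).trans_le (hbd _)
  · intro V _ T hT i hi hiU M hM
    obtain ⟨g, hg⟩ := exists_injective_nat V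
    have hV : Nonempty V := ⟨i 0⟩
    -- A coding of `V` that inverts `i` below `K` and sends all other vertices to `K` or above.
    have hb : ∀ K : ℕ, ∃ b : V → ℕ, Function.Injective b ∧ ∀ u < K, b (i u) = u := by
      intro K
      refine ⟨fun v => if h : ∃ u < K, i u = v then h.choose else K + g v, ?_, ?_⟩
      · intro v w hvw
        simp only at hvw
        split_ifs at hvw with h1 h2 h2
        · rw [← h1.choose_spec.2, ← h2.choose_spec.2, hvw]
        · have := h1.choose_spec.1
          omega
        · have := h2.choose_spec.1
          omega
        · exact hg (by omega)
      · intro u hu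
        have h : ∃ u' < K, i u' = i u := ⟨u, hu, rfl⟩
        simp only [dif_pos h]
        exact hi h.choose_spec.2
    -- `k₀` bounds the vertices of `U` occurring in `M`, so the task, fixing everything below `k₀ +
    -- 1`, fixes all of them.
    obtain ⟨k₀, hk₀⟩ := (hM.preimage (f := i) hi.injOn).bddAbove
    obtain ⟨b, hbi, hbk⟩ := hb (k₀ + 1)
    obtain ⟨D, hD, -⟩ := exists_trace_of_injective T hbi hM
    obtain ⟨m, hm⟩ := htask ⟨k₀ + 1, (hM.image b).toFinset, D⟩
    have hdom : ∀ v ∈ M, b v ∈ (task m).dom := by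
      intro v hv
      rw [hm]
      simpa using ⟨v, hv, rfl⟩
    have hdom' : ∀ u ∈ (task m).dom, ∃ v ∈ M, b v = u := by
      intro u hu
      rw [hm] at hu
      simpa using hu
    have hreal : (p (m + 1)).Realizes (task m) := by
      rw [hp]
      refine (hdec (task m) (p m)).resolve_right (fun hno => ?_)
      rw [← hp] at hno
      have hK := hfix (task m) (p m)
      rw [← hp] at hK
      -- A negative decision is refuted by the trace of `T` on `M` together with the vertices below
      -- the current bound: it extends the current condition, since `T` extends `U`, and realizes
      -- the task.
      set K := (p (m + 1)).bd with hKdef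
      obtain ⟨b', hb'i, hb'k⟩ := hb K
      have hM' : (M ∪ i '' Set.Iio K).Finite := hM.union ((Set.finite_Iio K).image i)
      obtain ⟨D', hD', hD'r⟩ := exists_trace_of_injective T hb'i hM'
      obtain ⟨l, hl⟩ := (hM'.image b').bddAbove
      have hl' : ∀ v ∈ M ∪ i '' Set.Iio K, b' v < max K (l + 1) := fun v hv =>
        lt_max_of_lt_right (Nat.lt_succ_of_le (hl ⟨v, hv, rfl⟩))
      let q : Cond (L := L) F := ⟨max K (l + 1), D', by
        intro n R t ht k
        obtain ⟨s, hs, -, rfl⟩ := hD'r n R t ht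
        exact hl' _ (hs k), by
        refine hT.of_exists_lift b' hb'i (fun n R t ht => ?_)
        obtain ⟨s, -, h⟩ := hD'r n R t ht
        exact ⟨s, h⟩⟩
      refine hno q ⟨le_max_left _ _, fun n R t ht => ?_⟩ ⟨b' ∘ Function.invFun b, ?_, ?_, ?_, ?_⟩
      · have e : t = b' ∘ (i ∘ t) := funext fun k => (hb'k _ (ht k)).symm
        rw [← hU (m + 1) n R t ht, hiU]
        conv_lhs => rw [e]
        exact hD' n R _ (fun k => Or.inr ⟨t k, ht k, rfl⟩)
      · intro u hu v hv huv
        obtain ⟨u, -, rfl⟩ := hdom' u hu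
        obtain ⟨v, -, rfl⟩ := hdom' v hv
        simp only [Function.comp, Function.leftInverse_invFun hbi _] at huv
        rw [hb'i huv]
      · intro u hu
        obtain ⟨v, hv, rfl⟩ := hdom' u hu
        simp only [Function.comp, Function.leftInverse_invFun hbi _]
        exact hl' v (Or.inl hv)
      · intro u hu hlt
        have h1 : u < k₀ + 1 := by rw [hm] at hlt; exact hlt
        have h2 : u < K := lt_of_lt_of_le hlt hK
        rw [Function.comp, ← hb'k u h2]
        congr 1
        conv_lhs => rw [hb'k u h2, ← hbk u h1]
        exact Function.leftInverse_invFun hbi _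
      · intro n R t ht
        choose s hs hst using fun k => hdom' _ (ht k)
        have e : t = b ∘ s := funext fun k => (hst k).symm
        have e' : (b' ∘ Function.invFun b) ∘ t = b' ∘ s := by
          rw [e, Function.comp_assoc, ← Function.comp_assoc (Function.invFun b),
            Function.invFun_comp hbi]
          rfl
        rw [e', e, hm, hD n R s hs]
        exact (hD' n R s (fun k => Or.inl (hs k))).symm
    obtain ⟨e, he1, he2, he3, he4⟩ := hreal
    refine ⟨e ∘ b, ?_, ?_, ?_⟩
    · intro v hv w hw hvw
      exact hbi (he1 (hdom v hv) (hdom w hw) hvw)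
    · intro n R t ht
      rw [Function.comp_assoc, hU (m + 1) n R (e ∘ b ∘ t) (fun k => he2 _ (hdom _ (ht k))),
        ← he4 n R (b ∘ t) (fun k => hdom _ (ht k)), hm]
      exact (hD n R t ht).symm
    · intro u hu
      have hu' : u < k₀ + 1 := Nat.lt_succ_of_le (hk₀ hu)
      have := he3 (b (i u)) (hdom _ hu) (by rw [hbk u hu', hm]; exact hu')
      rw [Function.comp, this, hbk u hu']

end

/-! ### Components of the Gaifman graph off a set of vertices. -/

section Comp

variable {L : FirstOrder.Language.{0, 0}} {A : Type} [L.Structure A]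

/-- The vertices reachable from `p` without entering `N`. -/
def comp (L : FirstOrder.Language.{0, 0}) {A : Type} [L.Structure A] (N : Set A) (p : A) : Set A :=
  {a | Relation.ReflTransGen (fun x y => (gaifman L A).Adj x y ∧ y ∉ N) p a}

theorem self_mem_comp (N : Set A) (p : A) : p ∈ comp L N p := Relation.ReflTransGen.refl

theorem mem_comp_of_adj {N : Set A} {p x y : A} (hx : x ∈ comp L N p)
    (h : (gaifman L A).Adj x y) (hy : y ∉ N) : y ∈ comp L N p :=
  Relation.ReflTransGen.tail hx ⟨h, hy⟩

theorem notMem_of_mem_comp {N : Set A} {p x : A} (hp : p ∉ N) (hx : x ∈ comp L N p) : x ∉ N := by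
  cases hx with
  | refl => exact hp
  | tail _ h => exact h.2

theorem nbr_comp_subset (N : Set A) (p : A) : nbr L (comp L N p) ⊆ N := by
  rintro y ⟨hy, x, hx, hxy⟩
  by_contra h
  exact hy (mem_comp_of_adj hx hxy h)

theorem comp_subset_comp {N : Set A} {p q : A} (h : (gaifman L A).Adj p q) (hq : q ∉ N) :
    comp L N q ⊆ comp L N p :=
  fun _ hx => Relation.ReflTransGen.head ⟨h, hq⟩ hx

theorem connSet_comp (N : Set A) (p : A) : ConnSet L (comp L N p) := by
  rintro Z hZ ⟨z, hz⟩ hcl x hx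
  have hp : ∀ a ∈ comp L N p, a ∈ Z → p ∈ Z := by
    intro a ha
    induction ha with
    | refl => exact id
    | tail hb hbc ih => exact fun hc => ih (hcl _ hc _ hb hbc.1.symm)
  have hpZ := hp z (hZ hz) hz
  clear hz hp
  induction hx with
  | refl => exact hpZ
  | tail hb hbc ih => exact hcl _ ih _ (hb.tail hbc) hbc.1

end Comp

/-! ### Gluing along partial embeddings. -/

section

variable {L : FirstOrder.Language.{0, 0}} {ι : Type} {F : ι → Type} [∀ j, L.Structure (F j)]

/-- `f` preserves the tuples of `B` contained in `Q`. -/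
def HomOn {B V : Type} [L.Structure B] (Q : Set B) (f : B → V) (S : Rels L V) : Prop :=
  ∀ (n : ℕ) (R : L.Relations n) (t : Fin n → B), RelMap R t → (∀ k, t k ∈ Q) → S n R (f ∘ t)

/-- Every partial homomorphism from a member of the family to `N` can be replaced by one to `U`
which is compatible with the map `h` on `x`. -/
def Transfers (F : ι → Type) [∀ j, L.Structure (F j)] (N U : Rels L ℕ) (x : Set ℕ)
    (h : ℕ → ℕ) : Prop :=
  ∀ (j : ι) (Q : Set (F j)) (f : F j → ℕ), HomOn Q f N →
    ∃ g : F j → ℕ, HomOn Q g U ∧ ∀ q ∈ Q, f q ∈ x → g q = h (f q)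

/-- No structure avoiding the family has a constant tuple. -/
def LoopFree (L : FirstOrder.Language.{0, 0}) (F : ι → Type) [∀ j, L.Structure (F j)] : Prop :=
  ∀ (V : Type) (T : Rels L V), RForb F T → ∀ n R (v : V), ¬ T n R (fun _ => v)

/-- Data for gluing copies of structures `N i` to `U` along partial embeddings `h i`, defined on
`x i`, and imposing the structure `S` on the new points `s i`. -/
structure Gluing (F : ι → Type) [∀ j, L.Structure (F j)] (I : Type) where
  U : Rels L ℕ
  N : I → Rels L ℕ
  S : Rels L I
  x : I → Set ℕ
  h : I → ℕ → ℕ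
  s : I → ℕ
  U_forb : RForb F U
  N_forb : ∀ i, RForb F (N i)
  S_forb : RForb F S
  s_notMem : ∀ i, s i ∉ x i
  injOn : ∀ i, Set.InjOn (h i) (x i)
  emb : ∀ i n R t, (∀ k, t k ∈ x i) → (N i n R t ↔ U n R (h i ∘ t))
  transfers : ∀ i, Transfers F (N i) U (x i) (h i)
  eq_of_eq : ∀ i k, ∀ a ∈ x i, ∀ b ∈ x k, h i a = h k b → i = k
  sep : ∀ n R t, U n R t → (∀ k, ∃ i, t k ∈ h i '' x i) → ∃ i, ∀ k, t k ∈ h i '' x i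

namespace Gluing

variable {I : Type} (D : Gluing (L := L) F I)

open Classical in
/-- The inclusion of the copy of `N i`. -/
noncomputable def φ (i : I) (y : ℕ) : ℕ ⊕ I × ℕ :=
  if y ∈ D.x i then Sum.inl (D.h i y) else Sum.inr (i, y)

/-- The inclusion of the copy of `S`. -/
def σ (i : I) : ℕ ⊕ I × ℕ := Sum.inr (i, D.s i)

/-- The relations of the glued structure. -/
def T : Rels L (ℕ ⊕ I × ℕ) := fun n R t =>
  (∃ u, D.U n R u ∧ Sum.inl ∘ u = t) ∨ (∃ i u, D.N i n R u ∧ D.φ i ∘ u = t) ∨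
    ∃ u, D.S n R u ∧ D.σ ∘ u = t

/-- The set along which the copy of `N i` is glued. -/
def H (i : I) : Set (ℕ ⊕ I × ℕ) := {v | ∃ y ∈ D.x i, v = Sum.inl (D.h i y)}

variable {D}

theorem φ_of_mem {i : I} {y : ℕ} (h : y ∈ D.x i) : D.φ i y = Sum.inl (D.h i y) := if_pos h

theorem φ_of_notMem {i : I} {y : ℕ} (h : y ∉ D.x i) : D.φ i y = Sum.inr (i, y) := if_neg h

theorem φ_s (i : I) : D.φ i (D.s i) = D.σ i := φ_of_notMem (D.s_notMem i)

theorem φ_eq_inl {i : I} {y a : ℕ} (h : D.φ i y = Sum.inl a) : y ∈ D.x i ∧ D.h i y = a := by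
  by_cases hy : y ∈ D.x i
  · rw [φ_of_mem hy] at h
    exact ⟨hy, Sum.inl.inj h⟩
  · rw [φ_of_notMem hy] at h
    cases h

theorem φ_eq_inr {i : I} {y : ℕ} {a : I × ℕ} (h : D.φ i y = Sum.inr a) :
    y ∉ D.x i ∧ (i, y) = a := by
  by_cases hy : y ∈ D.x i
  · rw [φ_of_mem hy] at h
    cases h
  · rw [φ_of_notMem hy] at h
    exact ⟨hy, Sum.inr.inj h⟩

theorem φ_eq_σ {i k : I} {y : ℕ} (h : D.φ i y = D.σ k) : i = k ∧ y = D.s i := by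
  have := (φ_eq_inr h).2
  simp only [Prod.mk.injEq] at this
  obtain ⟨rfl, h⟩ := this
  exact ⟨rfl, h⟩

theorem σ_injective : Function.Injective D.σ := fun i k h => by
  simp only [σ, Sum.inr.injEq, Prod.mk.injEq] at h
  exact h.1

theorem φ_injective (i : I) : Function.Injective (D.φ i) := by
  intro a b hab
  by_cases hb : b ∈ D.x i
  · rw [φ_of_mem hb] at hab
    obtain ⟨ha, h⟩ := φ_eq_inl hab
    exact D.injOn i ha hb h
  · rw [φ_of_notMem hb] at hab
    have := (φ_eq_inr hab).2
    simpa using this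

theorem mem_H_of_φ_inl {i : I} {y : ℕ} (h : y ∈ D.x i) : D.φ i y ∈ D.H i := ⟨y, h, φ_of_mem h⟩

theorem eq_of_mem_H {i k : I} {v : ℕ ⊕ I × ℕ} (h : v ∈ D.H i) (h' : v ∈ D.H k) : i = k := by
  obtain ⟨a, ha, rfl⟩ := h
  obtain ⟨b, hb, e⟩ := h'
  exact D.eq_of_eq i k a ha b hb (Sum.inl.inj e)

theorem eq_of_φ_mem_H {i k : I} {y : ℕ} (h : D.φ i y ∈ D.H k) : i = k ∧ y ∈ D.x i := by
  obtain ⟨b, hb, e⟩ := h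
  obtain ⟨hy, h⟩ := φ_eq_inl e
  exact ⟨D.eq_of_eq i k y hy b hb h, hy⟩

theorem σ_notMem_H {i k : I} : D.σ i ∉ D.H k := by
  rintro ⟨y, -, h⟩
  cases h

section Image

variable {A : Type} [L.Structure A] {f : A → ℕ ⊕ I × ℕ}

/-- A tuple of `U` has no vertex in the right summand, so such an edge comes from a block or from
`S`. -/
theorem adj_inr (hf : ∀ (n : ℕ) (R : L.Relations n) (t : Fin n → A), RelMap R t → D.T n R (f ∘ t))
    {x y : A} (hxy : (gaifman L A).Adj x y) {a : I × ℕ} (hx : f x = Sum.inr a) :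
    (∃ i b c, f x = D.φ i b ∧ f y = D.φ i c) ∨ ∃ i k, f x = D.σ i ∧ f y = D.σ k := by
  obtain ⟨-, n, R, t, ht, ⟨k, rfl⟩, ⟨l, rfl⟩⟩ := hxy
  rcases hf n R t ht with ⟨u, hu, e⟩ | ⟨i, u, hu, e⟩ | ⟨u, hu, e⟩
  · have := congrFun e k
    simp only [Function.comp] at this
    rw [hx] at this
    cases this
  · exact Or.inl ⟨i, u k, u l, (congrFun e k).symm, (congrFun e l).symm⟩
  · exact Or.inr ⟨u k, u l, (congrFun e k).symm, (congrFun e l).symm⟩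

end Image

variable [IsEmpty (L.Relations 0)]

/-- Arities are positive. An empty tuple would belong to every part of the gluing at once. -/
theorem exists_fin {n : ℕ} (R : L.Relations n) : ∃ _ : Fin n, True := by
  cases n with
  | zero => exact isEmptyElim R
  | succ n => exact ⟨0, trivial⟩

theorem T_inl_iff {n : ℕ} {R : L.Relations n} {u : Fin n → ℕ} :
    D.T n R (Sum.inl ∘ u) ↔ D.U n R u := by
  constructor
  · rintro (⟨v, hv, e⟩ | ⟨i, v, hv, e⟩ | ⟨v, hv, e⟩)
    · rwa [← Sum.inl_injective.comp_left e]
    · have h := fun k => φ_eq_inl (congrFun e k)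
      have e' : D.h i ∘ v = u := funext fun k => (h k).2
      rw [← e', ← D.emb i n R v (fun k => (h k).1)]
      exact hv
    · obtain ⟨k, -⟩ := exists_fin R
      have := congrFun e k
      cases this
  · exact fun h => Or.inl ⟨u, h, rfl⟩

/-- For tuples of `U` this is `sep`; a tuple of a block meets the glued sets only in its own one, as
they are disjoint. -/
theorem T_sep {n : ℕ} {R : L.Relations n} {t : Fin n → ℕ ⊕ I × ℕ} (h : D.T n R t)
    (ht : ∀ k, ∃ i, t k ∈ D.H i) : ∃ i, ∀ k, t k ∈ D.H i := by
  rcases h with ⟨u, hu, rfl⟩ | ⟨i, u, hu, rfl⟩ | ⟨u, hu, rfl⟩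
  · obtain ⟨i, hi⟩ := D.sep n R u hu (fun k => by
      obtain ⟨i, y, hy, e⟩ := ht k
      exact ⟨i, y, hy, (Sum.inl.inj e).symm⟩)
    refine ⟨i, fun k => ?_⟩
    obtain ⟨y, hy, e⟩ := hi k
    exact ⟨y, hy, congrArg _ e.symm⟩
  · refine ⟨i, fun k => ?_⟩
    obtain ⟨i', h⟩ := ht k
    exact mem_H_of_φ_inl (eq_of_φ_mem_H h).2
  · obtain ⟨k, -⟩ := exists_fin R
    obtain ⟨i, h⟩ := ht k
    exact absurd h σ_notMem_H

section Image

variable {A : Type} [L.Structure A] {f : A → ℕ ⊕ I × ℕ}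

/-- A homomorphic image of a member of the family inside the glued structure contains no edge
between two of the new points. -/
theorem false_of_adj_σ (hF : HasConnectedCuts L F) (hloop : LoopFree L F) {j : ι} [Finite (F j)]
    (hA : IsHomImage L (F j) A) (finj : Function.Injective f)
    (hf : ∀ (n : ℕ) (R : L.Relations n) (t : Fin n → A), RelMap R t → D.T n R (f ∘ t))
    {a₀ a₁ : A} {i₀ i₁ : I} (h₀ : f a₀ = D.σ i₀) (h₁ : f a₁ = D.σ i₁) (hne : i₀ ≠ i₁)
    (hadj : (gaifman L A).Adj a₀ a₁) [L.IsRelational] : False := by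
  let HH : Set A := {a | ∃ i, f a ∈ D.H i}
  -- `G` is the piece around the given edge bounded by the glued sets; the sets `E p` will be the
  -- components outside `G` and its boundary.
  let G : Set A := comp L HH a₀
  let E : A → Set A := comp L (nbr L G)
  have σHH : ∀ {a i}, f a = D.σ i → a ∉ HH := by
    rintro a i ha ⟨k, hk⟩
    rw [ha] at hk
    exact σ_notMem_H hk
  have ha₀ : a₀ ∈ G := self_mem_comp _ _
  have ha₁ : a₁ ∈ G := mem_comp_of_adj ha₀ hadj (σHH h₁)
  have hGH : ∀ a ∈ G, a ∉ HH := fun a ha => notMem_of_mem_comp (σHH h₀) ha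
  have hNH : ∀ a ∈ nbr L G, a ∈ HH := fun a ha => nbr_comp_subset _ _ ha
  have hG : ∀ a ∈ G, ∃ i y, y ∉ D.x i ∧ f a = Sum.inr (i, y) := by
    intro a ha
    induction ha with
    | refl => exact ⟨i₀, D.s i₀, D.s_notMem _, h₀⟩
    | tail hb hbc ih =>
      obtain ⟨i, y, -, e⟩ := ih
      rcases adj_inr hf hbc.1 e with ⟨k, b, c, -, hc⟩ | ⟨k, k', -, hc⟩
      · have hcx : c ∉ D.x k := fun hcx => hbc.2 ⟨k, by rw [hc]; exact mem_H_of_φ_inl hcx⟩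
        exact ⟨k, c, hcx, by rw [hc, φ_of_notMem hcx]⟩
      · exact ⟨k', _, D.s_notMem _, hc⟩
  have hEG : ∀ p, p ∉ G → p ∉ nbr L G → ∀ a ∈ E p, a ∉ G := by
    intro p hpG hpN a ha
    induction ha with
    | refl => exact hpG
    | tail hb hbc ih =>
      intro hc
      exact notMem_of_mem_comp hpN hb ⟨ih, _, hc, hbc.1.symm⟩
  -- The neighbourhood of an outer component is connected and inside the glued sets. No tuple there
  -- passes from one glued set to another, so the component is attached to only one.
  have hsep : ∀ p, p ∉ G → p ∉ nbr L G → ∀ i, ∀ y ∈ nbr L (E p), f y ∈ D.H i →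
      ∀ z ∈ nbr L (E p), f z ∈ D.H i := by
    intro p hpG hpN i y hy hyi z hz
    have hconn : ConnIn L (nbr L (E p)) :=
      hF.connIn_nbr (j := j) _ A hA rfl (E p) G ⟨p, self_mem_comp _ _⟩ ⟨a₀, ha₀⟩
        (connSet_comp _ _) (connSet_comp _ _) (fun d hd h => hEG p hpG hpN d h hd)
        (fun d hd h => (nbr_comp_subset _ _ h).1 hd) (nbr_comp_subset _ _)
    refine hconn {a | f a ∈ D.H i} ⟨y, hyi, hy⟩ ?_ hz
    intro n R t ht htE k l hk
    obtain ⟨i', hi'⟩ := T_sep (hf n R t ht) (fun m => hNH _ (nbr_comp_subset _ _ (htE m)))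
    have e : i = i' := eq_of_mem_H hk (hi' k)
    subst e
    exact hi' l
  have hGN : ∀ {g y : A}, g ∈ G → (gaifman L A).Adj g y → y ∈ G ∨ y ∈ nbr L G := by
    intro g y hg hgy
    by_cases hy : y ∈ G
    · exact Or.inl hy
    · exact Or.inr ⟨hy, g, hg, hgy⟩
  have hnbrE : ∀ {p y : A}, p ∉ nbr L G → (gaifman L A).Adj p y → y ∈ nbr L G →
      y ∈ nbr L (E p) := fun hp hpy hy =>
    ⟨fun h => notMem_of_mem_comp hp h hy, _, self_mem_comp _ _, hpy⟩
  have hGadj : ∀ {g y : A} {i : I}, g ∈ G → (gaifman L A).Adj g y → f y ∈ D.H i →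
      ∃ b, f g = D.φ i b := by
    intro g y i hg hgy hy
    obtain ⟨k, b, -, e⟩ := hG g hg
    rcases adj_inr hf hgy e with ⟨i', b, c, hb, hc⟩ | ⟨k, k', -, hc⟩
    · rw [hc] at hy
      obtain ⟨rfl, -⟩ := eq_of_φ_mem_H hy
      exact ⟨b, hb⟩
    · rw [hc] at hy
      exact absurd hy σ_notMem_H
  have hGadj' : ∀ {g y : A} {i : I} {b : ℕ}, g ∈ G → (gaifman L A).Adj g y → f g = D.φ i b →
      b ≠ D.s i → ∃ c, f y = D.φ i c := by
    intro g y i b hg hgy hb hbs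
    obtain ⟨k, b', -, e⟩ := hG g hg
    rcases adj_inr hf hgy e with ⟨i', b'', c, hb'', hc⟩ | ⟨k', -, hk', -⟩
    · have h1 := (φ_eq_inr (hb.symm.trans e)).2
      have h2 := (φ_eq_inr (hb''.symm.trans e)).2
      have h3 : i = i' := by
        have := h1.trans h2.symm
        simp only [Prod.mk.injEq] at this
        exact this.1
      subst h3
      exact ⟨c, hc⟩
    · exact absurd (φ_eq_σ (hb.symm.trans hk')).2 hbs
  -- If a vertex of block `i` other than its new point occurs here, removing that new point (if
  -- present) separates it from a new point `a'` of another block. The side containing it consists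
  -- of such vertices and the outer components attached to `H i`.
  have key : ∀ a, a ∈ G ∨ a ∈ nbr L G → ∀ i y, f a = D.φ i y → y = D.s i := by
    intro a ha i y hy
    by_contra hys
    obtain ⟨a', ha', i', hi', hne'⟩ : ∃ a' ∈ G, ∃ i', f a' = D.σ i' ∧ i' ≠ i := by
      by_cases h : i₀ = i
      · exact ⟨a₁, ha₁, i₁, h₁, fun e => hne (h.trans e.symm)⟩
      · exact ⟨a₀, ha₀, i₀, h₀, h⟩
    let C : Set A := {b | f b = D.σ i}
    have hC : C.Subsingleton := fun b hb c hc => finj (hb.trans hc.symm)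
    refine hF.not_isCut hA hC ((isCut_iff C).2 ?_)
    have ofH : ∀ {z}, f z ∈ D.H i → ∃ b, b ≠ D.s i ∧ f z = D.φ i b := by
      rintro z ⟨b, hb, e⟩
      exact ⟨b, fun e' => D.s_notMem i (e' ▸ hb), by rw [φ_of_mem hb, e]⟩
    refine ⟨{z | z ∉ C ∧ (((z ∈ G ∨ z ∈ nbr L G) ∧ ∃ b, b ≠ D.s i ∧ f z = D.φ i b) ∨
      (z ∉ G ∧ z ∉ nbr L G ∧ ∃ w ∈ nbr L (E z), f w ∈ D.H i))}, ⟨a, ?_, Or.inl ⟨ha, y, hys, hy⟩⟩,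
      fun z hz => hz.1, ⟨a', ?_, ?_⟩, ?_⟩
    · intro haC
      exact hys (φ_eq_σ (hy.symm.trans haC)).2
    · intro h
      exact hne' (σ_injective (hi'.symm.trans h))
    · rintro ⟨-, ⟨-, b, -, e⟩ | ⟨h, -⟩⟩
      · exact hne' (φ_eq_σ (e.symm.trans hi')).1.symm
      · exact h ha'
    · rintro z ⟨hzC, hz⟩ v hvC hzv
      refine ⟨hvC, ?_⟩
      have hvs : ∀ {c}, f v = D.φ i c → c ≠ D.s i := by
        rintro c hc rfl
        exact hvC (hc.trans (φ_s i))
      rcases hz with ⟨hz | hz, b, hbs, hb⟩ | ⟨hzG, hzN, w, hw, hwi⟩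
      · obtain ⟨c, hc⟩ := hGadj' hz hzv hb hbs
        exact Or.inl ⟨hGN hz hzv, c, hvs hc, hc⟩
      · have hzi : f z ∈ D.H i := by
          obtain ⟨k, hk⟩ := hNH z hz
          rw [hb] at hk ⊢
          exact mem_H_of_φ_inl (eq_of_φ_mem_H hk).2
        by_cases hvG : v ∈ G
        · obtain ⟨c, hc⟩ := hGadj hvG hzv.symm hzi
          exact Or.inl ⟨Or.inl hvG, c, hvs hc, hc⟩
        by_cases hvN : v ∈ nbr L G
        · refine Or.inl ⟨Or.inr hvN, ofH ?_⟩
          obtain ⟨hzv', n, R, t, ht, ⟨k, rfl⟩, ⟨l, rfl⟩⟩ := hzv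
          -- An edge inside the boundary may come from a tuple with a further vertex off the glued
          -- sets. Whether in `G` or outside, that vertex ties both ends to the same glued set.
          by_cases hall : ∀ m, t m ∈ HH
          · obtain ⟨i', hi'⟩ := T_sep (hf n R t ht) hall
            have e : i = i' := eq_of_mem_H hzi (hi' k)
            subst e
            exact hi' l
          push Not at hall
          obtain ⟨m, hm⟩ := hall
          have hmk : (gaifman L A).Adj (t m) (t k) :=
            adj_of_relMap ht (fun e => hm (e ▸ hNH _ hz))
          have hml : (gaifman L A).Adj (t m) (t l) :=
            adj_of_relMap ht (fun e => hm (e ▸ hNH _ hvN))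
          have hmN : t m ∉ nbr L G := fun h => hm (hNH _ h)
          by_cases hmG : t m ∈ G
          · obtain ⟨c, hc⟩ := hGadj hmG hmk hzi
            obtain ⟨k', hk'⟩ := hNH _ hvN
            obtain ⟨d, hd⟩ := hGadj hmG hml hk'
            obtain ⟨p, q, -, e⟩ := hG _ hmG
            have h1 := (φ_eq_inr (hc.symm.trans e)).2
            have h2 := (φ_eq_inr (hd.symm.trans e)).2
            have h3 : i = k' := by
              have := h1.trans h2.symm
              simp only [Prod.mk.injEq] at this
              exact this.1
            subst h3
            exact hk'
          · exact hsep _ hmG hmN i _ (hnbrE hmN hmk hz) hzi _ (hnbrE hmN hml hvN)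
        · exact Or.inr ⟨hvG, hvN, z, hnbrE hvN hzv.symm hz, hzi⟩
      · have hvG : v ∉ G := fun h => (hGN h hzv.symm).elim hzG hzN
        by_cases hvN : v ∈ nbr L G
        · exact Or.inl ⟨Or.inr hvN, ofH (hsep z hzG hzN i w hw hwi v (hnbrE hzN hzv hvN))⟩
        · refine Or.inr ⟨hvG, hvN, w, ?_, hwi⟩
          have e : E v = E z := Set.Subset.antisymm (comp_subset_comp hzv hvN)
            (comp_subset_comp hzv.symm hzN)
          rw [e]
          exact hw
  -- A boundary vertex lies in a glued set, hence is no new point, against `key`. So the boundary is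
  -- empty and, by connectedness, `G` is everything.
  have hN : ∀ a, a ∉ nbr L G := by
    intro a ha
    obtain ⟨i, y, hy, e⟩ := hNH a ha
    have := key a (Or.inr ha) i y (by rw [e, φ_of_mem hy])
    exact D.s_notMem i (this ▸ hy)
  have huniv : ∀ a, a ∈ G := by
    intro a
    by_contra ha
    refine hF.not_isCut hA Set.subsingleton_empty ((isCut_iff ∅).2
      ⟨G, ⟨a₀, ha₀⟩, fun _ _ => id, ⟨a, id, ha⟩, fun x hx y _ hxy => ?_⟩)
    exact (hGN hx hxy).resolve_right (hN y)
  have hσ : ∀ a, ∃ i, f a = D.σ i := by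
    intro a
    obtain ⟨i, y, hy, e⟩ := hG a (huniv a)
    have := key a (Or.inl (huniv a)) i y (by rw [e, φ_of_notMem hy])
    exact ⟨i, by rw [e, this]; rfl⟩
  choose r hr using hσ
  obtain ⟨p, -⟩ := hA
  refine D.S_forb j (r ∘ p) (fun n R t ht => ?_)
  have hfp : ∀ k, (f ∘ p ∘ t) k = D.σ (r (p (t k))) := fun k => hr _
  rcases hf n R (p ∘ t) (p.map_rel R t ht) with ⟨u, hu, e⟩ | ⟨i, u, hu, e⟩ | ⟨u, hu, e⟩
  · obtain ⟨k, -⟩ := exists_fin R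
    have := (congrFun e k).trans (hfp k)
    cases this
  · have hus : u = fun _ => D.s i :=
      funext fun k => (φ_eq_σ ((congrFun e k).trans (hfp k))).2
    exact absurd (hus ▸ hu) (hloop _ _ (D.N_forb i) n R (D.s i))
  · have : u = (r ∘ p) ∘ t := funext fun k => σ_injective ((congrFun e k).trans (hfp k))
    exact this ▸ hu

end Image

/-- The glued structure avoids the family. -/
theorem T_forb (hF : HasConnectedCuts L F) (hloop : LoopFree L F) [∀ j, Finite (F j)]
    [L.IsRelational] : RForb F D.T := by
  intro j f hf
  by_cases hS : ∃ (n : ℕ) (R : L.Relations n) (t : Fin n → F j) (u : Fin n → I),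
      RelMap R t ∧ D.S n R u ∧ D.σ ∘ u = f ∘ t
  · obtain ⟨n, R, t, u, ht, hu, e⟩ := hS
    obtain ⟨k, -⟩ := exists_fin R
    obtain ⟨l, hl⟩ : ∃ l, u k ≠ u l := by
      by_contra h
      push Not at h
      have : u = fun _ => u k := funext fun l => (h l).symm
      exact hloop _ _ D.S_forb n R (u k) (this ▸ hu)
    let g : F j → Set.range f := Set.rangeFactorization f
    let := imageStructure (L := L) g
    have hrel : RelMap R (g ∘ t) := ⟨t, ht, rfl⟩
    have hk : (g (t k)).1 = D.σ (u k) := (congrFun e k).symm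
    have hl' : (g (t l)).1 = D.σ (u l) := (congrFun e l).symm
    refine false_of_adj_σ (A := Set.range f) (f := Subtype.val) (D := D) hF hloop (j := j)
      (isHomImage_imageStructure g Set.rangeFactorization_surjective)
      Subtype.val_injective ?_ hk hl' hl (adj_of_relMap hrel ?_)
    · rintro n R _ ⟨s, hs, rfl⟩
      exact hf n R s hs
    · intro h
      exact hl (σ_injective (hk.symm.trans ((congrArg Subtype.val h).trans hl')))
  · have hblock : ∀ (n : ℕ) (R : L.Relations n) (t : Fin n → F j), RelMap R t →
        (∃ u, D.U n R u ∧ Sum.inl ∘ u = f ∘ t) ∨ ∃ i u, D.N i n R u ∧ D.φ i ∘ u = f ∘ t := by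
      intro n R t ht
      rcases hf n R t ht with h | h | ⟨u, hu, e⟩
      · exact Or.inl h
      · exact Or.inr h
      · exact absurd ⟨n, R, t, u, ht, hu, e⟩ hS
    -- The part of the member landing in block `i` is pulled back to `N i` and then transferred to
    -- `U`. The results agree with `f` on the glued sets, so they combine with its values in `U`.
    let Q : I → Set (F j) := fun i => {q | ∃ y, D.φ i y = f q}
    have hex : ∀ i, ∃ r : F j → ℕ, ∀ q ∈ Q i, D.φ i (r q) = f q := by
      intro i
      classical
      exact ⟨fun q => if h : q ∈ Q i then h.choose else 0, fun q hq => by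
        simp only [dif_pos hq]
        exact hq.choose_spec⟩
    choose r hr using hex
    have hrh : ∀ i, HomOn (Q i) (r i) (D.N i) := by
      intro i n R t ht htQ
      have hrt : ∀ k, D.φ i (r i (t k)) = f (t k) := fun k => hr i _ (htQ k)
      rcases hblock n R t ht with ⟨u, hu, e⟩ | ⟨i', u, hu, e⟩
      · have h := fun k => φ_eq_inl ((hrt k).trans (congrFun e k).symm)
        rw [D.emb i n R (r i ∘ t) (fun k => (h k).1)]
        have e' : D.h i ∘ r i ∘ t = u := funext fun k => (h k).2
        rwa [e']
      · have hi : i' = i := by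
          obtain ⟨k, -⟩ := exists_fin R
          have hk := (hrt k).trans (congrFun e k).symm
          simp only [Function.comp] at hk
          by_cases hx : u k ∈ D.x i'
          · have := mem_H_of_φ_inl hx
            rw [← hk] at this
            exact (eq_of_φ_mem_H this).1.symm
          · rw [φ_of_notMem hx] at hk
            have := (φ_eq_inr hk).2
            simp only [Prod.mk.injEq] at this
            exact this.1.symm
        subst hi
        have e' : r i' ∘ t = u :=
          funext fun k => φ_injective i' ((hrt k).trans (congrFun e k).symm)
        rwa [e']
    choose g hg hgr using fun i => D.transfers i j (Q i) (r i) (hrh i)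
    refine D.U_forb j (fun q => Sum.elim id (fun a => g a.1 q) (f q)) (fun n R t ht => ?_)
    rcases hblock n R t ht with ⟨u, hu, e⟩ | ⟨i, u, hu, e⟩
    · have e' : (fun q => Sum.elim id (fun a => g a.1 q) (f q)) ∘ t = u := by
        funext k
        have := congrFun e k
        simp only [Function.comp] at this ⊢
        rw [← this]
        rfl
      rwa [e']
    · have htQ : ∀ k, t k ∈ Q i := fun k => ⟨u k, congrFun e k⟩
      have e' : (fun q => Sum.elim id (fun a => g a.1 q) (f q)) ∘ t = g i ∘ t := by
        funext k
        have hk := hr i _ (htQ k)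
        simp only [Function.comp]
        by_cases hx : r i (t k) ∈ D.x i
        · rw [hgr i _ (htQ k) hx, ← hk, φ_of_mem hx]
          rfl
        · rw [← hk, φ_of_notMem hx]
          rfl
      rw [e']
      exact hg i n R t ht htQ

end Gluing

end

/-! ### Partial embeddings, universality and weak indivisibility. -/

section

variable {L : FirstOrder.Language.{0, 0}} {ι : Type} {F : ι → Type} [∀ j, L.Structure (F j)]

/-- The partial homomorphisms from members of the family to `N`, up to what they do on the finite
set `x`, all live in a finite set. -/
theorem exists_finite_base [Finite ι] [∀ j, Finite (F j)] (N : Rels L ℕ) {x : Set ℕ}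
    (hx : x.Finite) : ∃ W : Set ℕ, W.Finite ∧ ∀ (j : ι) (Q : Set (F j)) (f : F j → ℕ),
      HomOn Q f N → ∃ f' : F j → ℕ, HomOn Q f' N ∧ (∀ q, f' q ∈ W) ∧
        ∀ q, f q ∈ x → f' q = f q := by
  classical
  have := hx.to_subtype
  -- Only the pattern of `f` on `x` matters. There are finitely many choices of member, domain and
  -- pattern, and one representative of each suffices.
  let key : ∀ {j : ι}, (F j → ℕ) → F j → Option x := fun f q =>
    if h : f q ∈ x then some ⟨f q, h⟩ else none
  have hex : ∀ a : (Σ j, Set (F j) × (F j → Option x)), ∃ f' : F a.1 → ℕ,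
      ∀ f : F a.1 → ℕ, HomOn a.2.1 f N → key f = a.2.2 →
        HomOn a.2.1 f' N ∧ key f' = a.2.2 := by
    intro a
    by_cases h : ∃ f : F a.1 → ℕ, HomOn a.2.1 f N ∧ key f = a.2.2
    · obtain ⟨f, hf⟩ := h
      exact ⟨f, fun _ _ _ => hf⟩
    · exact ⟨fun _ => 0, fun f h1 h2 => absurd ⟨f, h1, h2⟩ h⟩
  choose c hc using hex
  refine ⟨⋃ a, Set.range (c a), Set.finite_iUnion fun a => Set.finite_range _,
    fun j Q f hf => ?_⟩
  obtain ⟨h1, h2⟩ := hc ⟨j, Q, key f⟩ f hf rfl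
  refine ⟨c ⟨j, Q, key f⟩, h1, fun q => Set.mem_iUnion.2 ⟨⟨j, Q, key f⟩, q, rfl⟩, fun q hq => ?_⟩
  have h3 := congrFun h2 q
  simp only [key, dif_pos hq] at h3
  split_ifs at h3 with h4
  simpa using h3

namespace Gluing

variable {I : Type} {D : Gluing (L := L) F I} [IsEmpty (L.Relations 0)]

omit [IsEmpty (L.Relations 0)] in
theorem eq_of_φ_eq_φ {i k : I} {a b : ℕ} (h : D.φ i a = D.φ k b) : i = k := by
  by_cases ha : a ∈ D.x i
  · have := mem_H_of_φ_inl ha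
    rw [h] at this
    exact (eq_of_φ_mem_H this).1.symm
  · rw [φ_of_notMem ha] at h
    have := (φ_eq_inr h.symm).2
    simp only [Prod.mk.injEq] at this
    exact this.1.symm

/-- A tuple of `S` inside one block would be constant, since a block has a single new point. -/
theorem T_φ_iff (hloop : LoopFree L F) {i : I} {n : ℕ} {R : L.Relations n} {u : Fin n → ℕ} :
    D.T n R (D.φ i ∘ u) ↔ D.N i n R u := by
  refine ⟨?_, fun h => Or.inr (Or.inl ⟨i, u, h, rfl⟩)⟩
  rintro (⟨v, hv, e⟩ | ⟨k, v, hv, e⟩ | ⟨v, hv, e⟩)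
  · have h := fun l => φ_eq_inl (congrFun e l).symm
    rw [D.emb i n R u (fun l => (h l).1)]
    have e' : D.h i ∘ u = v := funext fun l => (h l).2
    rwa [e']
  · obtain ⟨l, -⟩ := exists_fin R
    have hki : k = i := eq_of_φ_eq_φ (congrFun e l)
    subst hki
    rwa [← (φ_injective k).comp_left e]
  · exfalso
    have hv' : v = fun _ => i := funext fun l => (φ_eq_σ (congrFun e l).symm).1.symm
    exact hloop _ _ D.S_forb n R i (hv' ▸ hv)

theorem T_σ_iff (hloop : LoopFree L F) {n : ℕ} {R : L.Relations n} {u : Fin n → I} :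
    D.T n R (D.σ ∘ u) ↔ D.S n R u := by
  refine ⟨?_, fun h => Or.inr (Or.inr ⟨u, h, rfl⟩)⟩
  rintro (⟨v, hv, e⟩ | ⟨k, v, hv, e⟩ | ⟨v, hv, e⟩)
  · obtain ⟨l, -⟩ := exists_fin R
    have := congrFun e l
    cases this
  · exfalso
    have hv' : v = fun _ => D.s k := funext fun l => (φ_eq_σ (congrFun e l)).2
    exact hloop _ _ (D.N_forb k) n R (D.s k) (hv' ▸ hv)
  · rwa [← σ_injective.comp_left e]

/-- The new points of a gluing can be realized in an existentially closed structure. -/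
theorem exists_points [L.IsRelational] [Finite ι] [∀ j, Finite (F j)] [Finite I]
    (hF : HasConnectedCuts L F) (hloop : LoopFree L F) (hEC : IsEC F D.U)
    (hx : ∀ i, (D.x i).Finite) {X : Set ℕ} (hX : X.Finite) :
    ∃ v : I → ℕ, Function.Injective v ∧ (∀ n R t, D.S n R t ↔ D.U n R (v ∘ t)) ∧
      ∀ i, v i ∉ X ∧ v i ∉ D.h i '' D.x i ∧
        (∀ n R t, (∀ k, t k ∈ insert (D.s i) (D.x i)) →
          (D.N i n R t ↔ D.U n R (Function.update (D.h i) (D.s i) (v i) ∘ t))) ∧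
        Transfers F (D.N i) D.U (insert (D.s i) (D.x i))
          (Function.update (D.h i) (D.s i) (v i)) ∧
        ∀ n R t, D.U n R t → (∀ k, t k ∈ X ∨ t k ∈ D.h i '' D.x i ∨ t k = v i) →
          (∃ k, t k = v i) → ∀ k, t k ∈ D.h i '' D.x i ∨ t k = v i := by
  classical
  choose W hW hWb using fun i => exists_finite_base (F := F) (D.N i) ((hx i).insert (D.s i))
  -- Including the finite bases `W i` lets one finite part of the gluing carry all transfers.
  let M : Set (ℕ ⊕ I × ℕ) := Sum.inl '' (X ∪ ⋃ i, D.h i '' D.x i) ∪ Set.range D.σ ∪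
    ⋃ i, D.φ i '' W i
  have hM : M.Finite := by
    refine Set.Finite.union (Set.Finite.union (Set.Finite.image _ (hX.union
      (Set.finite_iUnion fun i => (hx i).image _))) (Set.finite_range _))
      (Set.finite_iUnion fun i => (hW i).image _)
  have hMX : ∀ b ∈ X, Sum.inl b ∈ M := fun b hb => Or.inl (Or.inl ⟨b, Or.inl hb, rfl⟩)
  have hMH : ∀ i, ∀ b ∈ D.h i '' D.x i, Sum.inl b ∈ M := fun i b hb =>
    Or.inl (Or.inl ⟨b, Or.inr (Set.mem_iUnion.2 ⟨i, hb⟩), rfl⟩)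
  have hMσ : ∀ i, D.σ i ∈ M := fun i => Or.inl (Or.inr ⟨i, rfl⟩)
  have hMW : ∀ i, ∀ b ∈ W i, D.φ i b ∈ M := fun i b hb =>
    Or.inr (Set.mem_iUnion.2 ⟨i, b, hb, rfl⟩)
  obtain ⟨e, he, heT, heU⟩ := hEC _ D.T (T_forb hF hloop) Sum.inl Sum.inl_injective
    (fun n R t => T_inl_iff.symm) M hM
  have hφM : ∀ i, ∀ y ∈ insert (D.s i) (D.x i), D.φ i y ∈ M := by
    rintro i y (rfl | hy)
    · rw [φ_s]
      exact hMσ i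
    · rw [φ_of_mem hy]
      exact hMH i _ ⟨y, hy, rfl⟩
  have heφ : ∀ i, ∀ y ∈ insert (D.s i) (D.x i),
      e (D.φ i y) = Function.update (D.h i) (D.s i) (e (D.σ i)) y := by
    rintro i y (rfl | hy)
    · rw [φ_s, Function.update_self]
    · have hys : y ≠ D.s i := fun h => D.s_notMem i (h ▸ hy)
      rw [Function.update_of_ne hys, φ_of_mem hy]
      exact heU _ (hMH i _ ⟨y, hy, rfl⟩)
  have hne : ∀ i b, Sum.inl b ∈ M → e (D.σ i) ≠ b := by
    intro i b hb h
    have := he (hMσ i) hb (h.trans (heU b hb).symm)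
    cases this
  refine ⟨fun i => e (D.σ i), fun i k h => σ_injective (he (hMσ i) (hMσ k) h), ?_,
    fun i => ⟨fun h => hne i _ (hMX _ h) rfl, fun h => hne i _ (hMH i _ h) rfl, ?_, ?_, ?_⟩⟩
  · intro n R t
    rw [← T_σ_iff hloop]
    exact heT n R _ (fun k => hMσ _)
  · intro n R t ht
    rw [← T_φ_iff hloop, heT n R (D.φ i ∘ t) (fun k => hφM i _ (ht k))]
    have e' : e ∘ D.φ i ∘ t = Function.update (D.h i) (D.s i) (e (D.σ i)) ∘ t :=
      funext fun k => heφ i _ (ht k)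
    rw [e']
  · intro j Q f hf
    obtain ⟨f', hf', hfW, hff⟩ := hWb i j Q f hf
    refine ⟨e ∘ D.φ i ∘ f', fun n R t ht htQ => ?_, fun q _ hq => ?_⟩
    · exact (heT n R (D.φ i ∘ f' ∘ t) (fun k => hMW i _ (hfW _))).1
        ((T_φ_iff hloop).2 (hf' n R t ht htQ))
    · rw [Function.comp, Function.comp, hff q hq]
      exact heφ i _ hq
  · rintro n R t ht htX ⟨k₀, hk₀⟩ k
    by_cases hk : t k = e (D.σ i)
    · exact Or.inr hk
    left
    -- Pull the tuple back to the gluing, where a new point shares tuples with vertices of `U` only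
    -- inside its own block.
    let t' : Fin n → ℕ ⊕ I × ℕ := fun k => if t k = e (D.σ i) then D.σ i else Sum.inl (t k)
    have ht'M : ∀ k, t' k ∈ M ∧ e (t' k) = t k := by
      intro k
      by_cases h : t k = e (D.σ i)
      · simp only [t', if_pos h]
        exact ⟨hMσ i, h.symm⟩
      · simp only [t', if_neg h]
        have : Sum.inl (t k) ∈ M := by
          rcases htX k with h' | h' | h'
          exacts [hMX _ h', hMH i _ h', absurd h' h]
        exact ⟨this, heU _ this⟩
    have hT : D.T n R t' := by
      rw [heT n R t' (fun k => (ht'M k).1)]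
      have : e ∘ t' = t := funext fun k => (ht'M k).2
      rwa [this]
    have h0 : t' k₀ = D.σ i := if_pos hk₀
    have h1 : t' k = Sum.inl (t k) := if_neg hk
    rcases hT with ⟨u, hu, e'⟩ | ⟨i', u, hu, e'⟩ | ⟨u, hu, e'⟩
    · have := (congrFun e' k₀).trans h0
      cases this
    · obtain ⟨rfl, -⟩ := φ_eq_σ ((congrFun e' k₀).trans h0)
      obtain ⟨h2, h3⟩ := φ_eq_inl ((congrFun e' k).trans h1)
      exact ⟨u k, h2, h3⟩
    · have := (congrFun e' k).trans h1
      cases this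

end Gluing

/-- An embedding of the first `n` vertices of `N` into `U`, with values in `B`, which is compatible
with all partial homomorphisms and freely placed with respect to `X`. -/
structure PartialEmb (F : ι → Type) [∀ j, L.Structure (F j)] (N U : Rels L ℕ) (X B : Set ℕ) (n : ℕ)
    (h : ℕ → ℕ) : Prop where
  injOn : Set.InjOn h (Set.Iio n)
  emb : ∀ m R t, (∀ k, t k ∈ Set.Iio n) → (N m R t ↔ U m R (h ∘ t))
  transfers : Transfers F N U (Set.Iio n) h
  mem : ∀ k ∈ Set.Iio n, h k ∈ B
  notMem : ∀ k ∈ Set.Iio n, h k ∉ X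
  free : ∀ m R t, U m R t → (∀ k, t k ∈ X ∨ t k ∈ h '' Set.Iio n) →
    (∀ k, t k ∈ X) ∨ ∀ k, t k ∈ h '' Set.Iio n

theorem PartialEmb.zero [IsEmpty (L.Relations 0)] {N U : Rels L ℕ} {X B : Set ℕ}
    (h : Transfers F N U ∅ id) : PartialEmb F N U X B 0 id where
  injOn := fun a ha => absurd ha (Nat.not_lt_zero a)
  emb := fun m R t ht => by
    cases m with
    | zero => exact isEmptyElim R
    | succ m => exact absurd (ht 0) (Nat.not_lt_zero _)
  transfers := by
    have : Set.Iio 0 = (∅ : Set ℕ) := by ext; simp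
    rwa [this]
  mem := fun a ha => absurd ha (Nat.not_lt_zero a)
  notMem := fun a ha => absurd ha (Nat.not_lt_zero a)
  free := fun m R t _ ht => Or.inl fun k => (ht k).elim id (by
    rintro ⟨a, ha, -⟩
    exact absurd ha (Nat.not_lt_zero a))

theorem Transfers.refl (U : Rels L ℕ) (x : Set ℕ) : Transfers F U U x id :=
  fun _ _ f hf => ⟨f, hf, fun _ _ _ => rfl⟩

/-- If partial embeddings can always be extended by one vertex, then there is an embedding. -/
theorem PartialEmb.exists_embedding {N U : Rels L ℕ} {X B : Set ℕ} {h₀ : ℕ → ℕ}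
    (hzero : PartialEmb F N U X B 0 h₀)
    (hsucc : ∀ n h, PartialEmb F N U X B n h →
      ∃ v, PartialEmb F N U X B (n + 1) (Function.update h n v)) :
    ∃ g : ℕ → ℕ, Function.Injective g ∧ (∀ n R t, N n R t ↔ U n R (g ∘ t)) ∧ ∀ k, g k ∈ B := by
  choose v hv using hsucc
  let st : ∀ n, {h // PartialEmb F N U X B n h} := fun n =>
    Nat.rec ⟨h₀, hzero⟩ (fun n h => ⟨Function.update h.1 n (v n h.1 h.2), hv n h.1 h.2⟩) n
  have hst : ∀ n, (st (n + 1)).1 = Function.update (st n).1 n (v n (st n).1 (st n).2) :=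
    fun n => rfl
  have hstab : ∀ k n, k < n → (st n).1 k = (st (k + 1)).1 k := by
    intro k n hkn
    induction n, hkn using Nat.le_induction with
    | base => rfl
    | succ n hn ih => rw [hst n, Function.update_of_ne (by omega), ih]
  have hagree : ∀ n k, k < n → (st (k + 1)).1 k = (st n).1 k := fun n k h => (hstab k n h).symm
  refine ⟨fun k => (st (k + 1)).1 k, ?_, ?_, fun k => (st (k + 1)).2.mem k (Nat.lt_succ_self k)⟩
  · intro a b hab
    have ha : a < max a b + 1 := by omega
    have hb : b < max a b + 1 := by omega
    simp only [hagree _ a ha, hagree _ b hb] at hab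
    exact (st (max a b + 1)).2.injOn ha hb hab
  · intro n R t
    obtain ⟨m, hm⟩ := (Set.finite_range t).bddAbove
    have ht : ∀ k, t k < m + 1 := fun k => Nat.lt_succ_of_le (hm ⟨k, rfl⟩)
    have e : (fun k => (st (k + 1)).1 k) ∘ t = (st (m + 1)).1 ∘ t :=
      funext fun k => hagree _ _ (ht k)
    rw [e]
    exact (st (m + 1)).2.emb n R t ht

/-- The one-point extensions produced by a gluing extend a partial embedding. -/
theorem PartialEmb.extend {N U : Rels L ℕ} {X Y B : Set ℕ} {n : ℕ} {h : ℕ → ℕ} {v : ℕ}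
    (hp : PartialEmb F N U X B n h) (hXY : X ⊆ Y) (hvB : v ∈ B) (hvY : v ∉ Y)
    (hvh : v ∉ h '' Set.Iio n)
    (hemb : ∀ m R t, (∀ k, t k ∈ insert n (Set.Iio n)) →
      (N m R t ↔ U m R (Function.update h n v ∘ t)))
    (htr : Transfers F N U (insert n (Set.Iio n)) (Function.update h n v))
    (hfree : ∀ m R t, U m R t → (∀ k, t k ∈ Y ∨ t k ∈ h '' Set.Iio n ∨ t k = v) →
      (∃ k, t k = v) → ∀ k, t k ∈ h '' Set.Iio n ∨ t k = v) :
    PartialEmb F N U X B (n + 1) (Function.update h n v) := by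
  have hIio : Set.Iio (n + 1) = insert n (Set.Iio n) := by
    ext k
    simp only [Set.mem_Iio, Set.mem_insert_iff]
    omega
  have hlt : ∀ k ∈ Set.Iio n, Function.update h n v k = h k := fun k hk =>
    Function.update_of_ne (ne_of_lt hk) _ _
  have hself : Function.update h n v n = v := Function.update_self _ _ _
  have himg : Function.update h n v '' Set.Iio (n + 1) = insert v (h '' Set.Iio n) := by
    rw [hIio, Set.image_insert_eq, hself, Set.image_congr hlt]
  refine ⟨?_, hIio ▸ hemb, hIio ▸ htr, ?_, ?_, ?_⟩
  · rw [hIio]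
    rintro a (rfl | ha) b (rfl | hb) hab
    · rfl
    · rw [hself, hlt b hb] at hab
      exact absurd ⟨b, hb, hab.symm⟩ hvh
    · rw [hself, hlt a ha] at hab
      exact absurd ⟨a, ha, hab⟩ hvh
    · rw [hlt a ha, hlt b hb] at hab
      exact hp.injOn ha hb hab
  · rw [hIio]
    rintro a (rfl | ha)
    · rwa [hself]
    · rw [hlt a ha]
      exact hp.mem a ha
  · rw [hIio]
    rintro a (rfl | ha)
    · rw [hself]
      exact fun h' => hvY (hXY h')
    · rw [hlt a ha]
      exact hp.notMem a ha
  · intro m R t ht htX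
    rw [himg] at htX ⊢
    by_cases hv : ∃ k, t k = v
    · right
      intro k
      have := hfree m R t ht (fun k => by
        rcases htX k with h1 | h1 | h1
        exacts [Or.inl (hXY h1), Or.inr (Or.inr h1), Or.inr (Or.inl h1)]) hv k
      exact this.symm
    · push Not at hv
      rcases hp.free m R t ht (fun k => by
        rcases htX k with h1 | h1 | h1
        exacts [Or.inl h1, absurd h1 (hv k), Or.inr h1]) with h1 | h1
      · exact Or.inl h1
      · exact Or.inr fun k => Or.inr (h1 k)

theorem IsHomImage.refl (L : FirstOrder.Language.{0, 0}) (A : Type) [L.Structure A] :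
    IsHomImage L A A :=
  ⟨FirstOrder.Language.Hom.id L A, fun a => ⟨a, rfl⟩, fun _ _ t ht => ⟨t, ht, fun _ => rfl⟩⟩

/-- Members of a family with connected cuts are connected. -/
theorem HasConnectedCuts.mem_of_closed (hF : HasConnectedCuts L F) {j : ι} [Finite (F j)]
    {Z : Set (F j)} {z : F j} (hz : z ∈ Z)
    (hZ : ∀ x ∈ Z, ∀ y, (gaifman L (F j)).Adj x y → y ∈ Z) (w : F j) : w ∈ Z := by
  by_contra hw
  exact hF.not_isCut (IsHomImage.refl L (F j)) Set.subsingleton_empty ((isCut_iff ∅).2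
    ⟨Z, ⟨z, hz⟩, fun _ _ => id, ⟨w, id, hw⟩, fun x hx y _ => hZ x hx y⟩)

/-- The disjoint union of `U` and `N` avoids the family because members are connected; existential
closedness copies a finite base of `N` into `U`. -/
theorem IsEC.transfers_empty [Finite ι] [∀ j, Finite (F j)] [IsEmpty (L.Relations 0)]
    (hF : HasConnectedCuts L F) {U N : Rels L ℕ} (hU : RForb F U) (hEC : IsEC F U)
    (hN : RForb F N) (h : ℕ → ℕ) : Transfers F N U ∅ h := by
  let T : Rels L (ℕ ⊕ ℕ) := fun n R t =>
    (∃ u, U n R u ∧ Sum.inl ∘ u = t) ∨ ∃ u, N n R u ∧ Sum.inr ∘ u = t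
  have hTU : ∀ n R t, T n R (Sum.inl ∘ t) → U n R t := by
    rintro n R t (⟨u, hu, e⟩ | ⟨u, hu, e⟩)
    · rwa [← Sum.inl_injective.comp_left e]
    · obtain ⟨k, -⟩ := Gluing.exists_fin R
      have := congrFun e k
      cases this
  have hTN : ∀ n R t, T n R (Sum.inr ∘ t) → N n R t := by
    rintro n R t (⟨u, hu, e⟩ | ⟨u, hu, e⟩)
    · obtain ⟨k, -⟩ := Gluing.exists_fin R
      have := congrFun e k
      cases this
    · rwa [← Sum.inr_injective.comp_left e]
  have hT : RForb F T := by
    intro j f hf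
    have hadj : ∀ x y, (gaifman L (F j)).Adj x y → ((f x).isLeft ↔ (f y).isLeft) := by
      rintro x y ⟨-, n, R, t, ht, ⟨k, rfl⟩, ⟨l, rfl⟩⟩
      rcases hf n R t ht with ⟨u, hu, e⟩ | ⟨u, hu, e⟩
      · have hk := congrFun e k
        have hl := congrFun e l
        simp only [Function.comp] at hk hl
        simp [← hk, ← hl]
      · have hk := congrFun e k
        have hl := congrFun e l
        simp only [Function.comp] at hk hl
        simp [← hk, ← hl]
    by_cases hz : ∃ z, (f z).isLeft
    · obtain ⟨z, hz⟩ := hz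
      have hall := hF.mem_of_closed (Z := {a | (f a).isLeft}) hz
        (fun x hx y hxy => (hadj x y hxy).1 hx)
      have hex : ∀ a, ∃ b, f a = Sum.inl b := fun a => Sum.isLeft_iff.1 (hall a)
      choose g hg using hex
      refine hU j g (fun n R t ht => hTU n R _ ?_)
      have e : Sum.inl ∘ g ∘ t = f ∘ t := funext fun k => (hg _).symm
      rw [e]
      exact hf n R t ht
    · push Not at hz
      have hex : ∀ a, ∃ b, f a = Sum.inr b := fun a =>
        Sum.isRight_iff.1 (Sum.not_isLeft.1 (hz a))
      choose g hg using hex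
      refine hN j g (fun n R t ht => hTN n R _ ?_)
      have e : Sum.inr ∘ g ∘ t = f ∘ t := funext fun k => (hg _).symm
      rw [e]
      exact hf n R t ht
  obtain ⟨W, hW, hWb⟩ := exists_finite_base (F := F) N Set.finite_empty
  obtain ⟨e, -, he, -⟩ := hEC _ T hT Sum.inl Sum.inl_injective
    (fun n R t => ⟨fun h => Or.inl ⟨t, h, rfl⟩, hTU n R t⟩) (Sum.inr '' W) (hW.image _)
  intro j Q f hf
  obtain ⟨f', hf', hfW, -⟩ := hWb j Q f hf
  refine ⟨e ∘ Sum.inr ∘ f', fun n R t ht htQ => ?_, fun q _ hq => absurd hq (Set.notMem_empty _)⟩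
  exact (he n R (Sum.inr ∘ f' ∘ t) (fun k => ⟨_, hfW _, rfl⟩)).1
    (Or.inr ⟨_, hf' n R t ht htQ, rfl⟩)

theorem rForb_false [∀ j, Nonempty (F j)] (hc : IsCovered L F) (V : Type) :
    RForb F (fun _ _ _ => False : Rels L V) := by
  intro j f h
  obtain ⟨n, R, t, ht, -⟩ := hc j (Classical.arbitrary _)
  exact h n R t ht

/-- Existentially closed structures are universal. -/
theorem IsEC.exists_embedding [L.IsRelational] [Finite ι] [∀ j, Finite (F j)]
    [∀ j, Nonempty (F j)] [IsEmpty (L.Relations 0)] (hc : IsCovered L F)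
    (hF : HasConnectedCuts L F) (hloop : LoopFree L F) {U N : Rels L ℕ} (hU : RForb F U)
    (hEC : IsEC F U) (hN : RForb F N) :
    ∃ g : ℕ → ℕ, Function.Injective g ∧ ∀ n R t, N n R t ↔ U n R (g ∘ t) := by
  obtain ⟨g, h1, h2, -⟩ := PartialEmb.exists_embedding (F := F) (N := N) (U := U) (X := ∅)
    (B := Set.univ) (PartialEmb.zero (hEC.transfers_empty hF hU hN id)) (fun n h hp => by
      let D : Gluing (L := L) F Unit :=
        { U := U
          N := fun _ => N
          S := fun _ _ _ => False
          x := fun _ => Set.Iio n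
          h := fun _ => h
          s := fun _ => n
          U_forb := hU
          N_forb := fun _ => hN
          S_forb := rForb_false hc Unit
          s_notMem := fun _ => lt_irrefl n
          injOn := fun _ => hp.injOn
          emb := fun _ => hp.emb
          transfers := fun _ => hp.transfers
          eq_of_eq := fun _ _ _ _ _ _ _ => rfl
          sep := fun m R t _ ht => ⟨(), fun k => (ht k).elim fun _ => id⟩ }
      obtain ⟨v, -, -, hv⟩ := D.exists_points hF hloop hEC (fun _ => Set.finite_Iio n)
        Set.finite_empty
      obtain ⟨h1, h2, h3, h4, h5⟩ := hv ()
      exact ⟨v (), hp.extend subset_rfl trivial h1 h2 h3 h4 h5⟩)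
  exact ⟨g, h1, h2⟩

/-- Existentially closed structures are weakly indivisible. -/
theorem IsEC.exists_embedding_of_finite [L.IsRelational] [Finite ι] [∀ j, Finite (F j)]
    [IsEmpty (L.Relations 0)] (hF : HasConnectedCuts L F) (hloop : LoopFree L F)
    {U : Rels L ℕ} (hU : RForb F U) (hEC : IsEC F U) {S B : Set ℕ} (hS : S.Finite)
    (hSB : ∀ v : S → ℕ, Function.Injective v →
      (∀ n R (t : Fin n → S), U n R (Subtype.val ∘ t) ↔ U n R (v ∘ t)) → ∃ i, v i ∈ B) :
    ∃ g : ℕ → ℕ, Function.Injective g ∧ (∀ n R t, U n R t ↔ U n R (g ∘ t)) ∧ ∀ k, g k ∈ B := by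
  classical
  by_contra hno
  have hstuck : ∀ X : Finset ℕ, ∃ n h, PartialEmb F U U X B n h ∧
      ∀ v, ¬ PartialEmb F U U X B (n + 1) (Function.update h n v) := by
    intro X
    by_contra hX
    push Not at hX
    exact hno (PartialEmb.exists_embedding (PartialEmb.zero (Transfers.refl U ∅)) hX)
  choose n h hp hs using hstuck
  -- Each stage absorbs the image of the embedding stuck over the previous stage, so later ones are
  -- disjoint from it and free over it. The vertices of `S`, being natural numbers, serve as stage
  -- indices.
  let X : ℕ → Finset ℕ := fun m => Nat.rec ∅ (fun _ Y => Y ∪ (Finset.range (n Y)).image (h Y)) m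
  have hXsucc : ∀ m, X (m + 1) = X m ∪ (Finset.range (n (X m))).image (h (X m)) := fun m => rfl
  have hXmono : Monotone X := monotone_nat_of_le_succ fun m => by
    rw [hXsucc]
    exact Finset.subset_union_left
  have himg : ∀ i k, i < k → ∀ b ∈ h (X i) '' Set.Iio (n (X i)), b ∈ X k := by
    rintro i k hik _ ⟨a, ha, rfl⟩
    refine hXmono (Nat.succ_le_of_lt hik) ?_
    rw [hXsucc]
    exact Finset.mem_union_right _ (Finset.mem_image_of_mem _ (Finset.mem_range.2 ha))
  have hdisj : ∀ i k, i < k → ∀ a ∈ Set.Iio (n (X i)), ∀ b ∈ Set.Iio (n (X k)),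
      h (X i) a ≠ h (X k) b := fun i k hik a ha b hb e =>
    (hp (X k)).notMem b hb (e ▸ himg i k hik _ ⟨a, ha, rfl⟩)
  have : Finite S := hS.to_subtype
  let D : Gluing (L := L) F S :=
    { U := U
      N := fun _ => U
      S := fun m R t => U m R (Subtype.val ∘ t)
      x := fun i => Set.Iio (n (X i))
      h := fun i => h (X i)
      s := fun i => n (X i)
      U_forb := hU
      N_forb := fun _ => hU
      S_forb := hU.comap Subtype.val (fun _ _ _ => id)
      s_notMem := fun i => lt_irrefl (n (X i))
      injOn := fun i => (hp (X i)).injOn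
      emb := fun i => (hp (X i)).emb
      transfers := fun i => (hp (X i)).transfers
      eq_of_eq := by
        intro i k a ha b hb e
        rcases lt_trichotomy i.1 k.1 with hik | hik | hik
        · exact absurd e (hdisj i k hik a ha b hb)
        · exact Subtype.ext hik
        · exact absurd e.symm (hdisj k i hik b hb a ha)
      sep := by
        intro m R t ht hti
        choose idx hidx using hti
        obtain ⟨l, -⟩ := Gluing.exists_fin R
        have : Nonempty (Fin m) := ⟨l⟩
        -- At the latest stage involved, every other entry lies in that stage's image or in the set
        -- it avoids. Freeness leaves only the image, since the entry `k₀` is not in the avoided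
        -- set.
        obtain ⟨k₀, hk₀⟩ := Finite.exists_max (fun k => (idx k).1)
        rcases (hp (X (idx k₀))).free m R t ht (fun k => by
          rcases (hk₀ k).lt_or_eq with hlt | heq
          · exact Or.inl (himg _ _ hlt _ (hidx k))
          · have := hidx k
            rw [Subtype.ext heq] at this
            exact Or.inr this) with h1 | h1
        · obtain ⟨a, ha, e⟩ := hidx k₀
          exact absurd (h1 k₀) (e ▸ (hp (X (idx k₀))).notMem a ha)
        · exact ⟨idx k₀, h1⟩ }
  let Y : S → Set ℕ := fun i => {b | b ∈ X i.1}
  have hY : (⋃ i, Y i).Finite := Set.finite_iUnion fun i => (X i.1).finite_toSet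
  obtain ⟨v, hv, hvS, hvi⟩ := D.exists_points hF hloop hEC (fun _ => Set.finite_Iio _)
    hY
  obtain ⟨i, hi⟩ := hSB v hv hvS
  obtain ⟨h1, h2, h3, h4, h5⟩ := hvi i
  exact hs (X i) (v i) ((hp (X i)).extend
    (Set.subset_iUnion Y i) hi h1 h2 h3 h4 h5)

/-- The structure with given relations. -/
@[reducible] def ofRels [L.IsRelational] {V : Type} (S : Rels L V) : L.Structure V where
  funMap := fun g => isEmptyElim g
  RelMap := fun R t => S _ R t

theorem forb_iff [L.IsRelational] {V : Type} [L.Structure V] :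
    Forb L F V ↔ RForb F (fun _ R t => RelMap R t : Rels L V) :=
  ⟨fun h j f hf => (h j).false (homOf f hf), fun h j => ⟨fun f => h j f (fun _ R t => f.map_rel R t)⟩⟩

/-- A constant tuple gives a one-vertex structure in the class with a tuple, not isomorphic to the
one without tuples. -/
theorem loopFree_of_unique [L.IsRelational] [∀ j, Nonempty (F j)] (hc : IsCovered L F)
    (h : ∀ (M N : Type) [L.Structure M] [L.Structure N] [Unique M] [Unique N],
      Forb L F M → Forb L F N → Nonempty (M ≃[L] N)) : LoopFree L F := by
  intro V T hT _ R v hv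
  let : L.Structure Unit := ofRels fun _ _ _ => False
  let : L.Structure (Fin 1) := ofRels fun n R _ => T n R fun _ => v
  obtain ⟨e⟩ := h Unit (Fin 1) (forb_iff.2 (rForb_false hc Unit))
    (forb_iff.2 (hT.comap (fun _ => v) (fun _ _ _ => id)))
  exact (e.map_rel R (fun _ => ())).1 hv

theorem exists_universal_of_covered [L.IsRelational] [Finite (Σ n, L.Relations n)] [Finite ι]
    [∀ j, Finite (F j)] [∀ j, Nonempty (F j)] [IsEmpty (L.Relations 0)] (hc : IsCovered L F)
    (hF : HasConnectedCuts L F) (hloop : LoopFree L F) :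
    ∃ (U : Type) (_ : L.Structure U), IsUniversal L F U ∧ IsWeaklyIndivisible L U := by
  obtain ⟨U, hU, hEC⟩ := exists_isEC hc
  let := ofRels U
  refine ⟨ℕ, ofRels U, ⟨inferInstance, forb_iff.2 hU, ?_⟩, ?_⟩
  · intro M _ _ hM
    rcases isEmpty_or_nonempty M with hM' | hM'
    · refine ⟨embOf (fun a => isEmptyElim a) (fun a => isEmptyElim a) (fun n R t => ?_)⟩
      obtain ⟨k, -⟩ := Gluing.exists_fin R
      exact isEmptyElim (t k)
    · obtain ⟨b, hb⟩ := exists_injective_nat M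
      let N : Rels L ℕ := fun n R t => ∃ s : Fin n → M, RelMap R s ∧ b ∘ s = t
      have hN : RForb F N := (forb_iff.1 hM).of_exists_lift b hb (fun n R t h => h)
      obtain ⟨g, hg, hgN⟩ := hEC.exists_embedding hc hF hloop hU hN
      refine ⟨embOf (g ∘ b) (hg.comp hb) (fun n R t => ?_)⟩
      refine Iff.trans ⟨fun h => ⟨t, h, rfl⟩, ?_⟩ (hgN n R (b ∘ t))
      rintro ⟨s, hs, e⟩
      rwa [← hb.comp_left e]
  · rintro A B - hAB ⟨S, hS, hSA⟩
    obtain ⟨g, hg, hgU, hgB⟩ := hEC.exists_embedding_of_finite hF hloop hU hS (B := B)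
      (fun v hv hvS => by
        by_contra hno
        push Not at hno
        have hvA : ∀ i, v i ∈ A := fun i =>
          ((hAB ▸ Set.mem_univ (v i) : v i ∈ A ∪ B)).resolve_right (hno i)
        exact hSA.false (embOf (A := induced L S) (B := induced L A) (fun i => ⟨v i, hvA i⟩)
          (fun a b hab => hv (congrArg Subtype.val hab)) (fun n R t => hvS n R t)))
    exact ⟨embOf (B := induced L B) (fun k => ⟨g k, hgB k⟩)
      (fun a b hab => hg (congrArg Subtype.val hab)) (fun n R t => hgU n R t)⟩

/-- A vertex in no tuple is isolated, so its connected member is that vertex alone and maps to every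
nonempty structure. -/
theorem isEmpty_of_not_isCovered [L.IsRelational] [∀ j, Finite (F j)] [IsEmpty (L.Relations 0)]
    (hF : HasConnectedCuts L F) (hc : ¬ IsCovered L F) (M : Type) [L.Structure M]
    (hM : Forb L F M) : IsEmpty M := by
  refine ⟨fun m => ?_⟩
  unfold IsCovered at hc
  push Not at hc
  obtain ⟨j, q, hq⟩ := hc
  have hall : ∀ w : F j, w = q := hF.mem_of_closed (Z := {q}) rfl (by
    rintro x rfl y ⟨-, n, R, t, ht, ⟨k, hk⟩, -⟩
    exact absurd hk (hq n R t ht k))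
  exact (hM j).false (homOf (fun _ => m) (fun n R t ht => by
    obtain ⟨k, -⟩ := Gluing.exists_fin R
    exact absurd (hall (t k)) (hq n R t ht k)))

theorem exists_universal [L.IsRelational] [Finite (Σ n, L.Relations n)] [Finite ι]
    [∀ j, Finite (F j)] [∀ j, Nonempty (F j)] [IsEmpty (L.Relations 0)]
    (hF : HasConnectedCuts L F)
    (h : ∀ (M N : Type) [L.Structure M] [L.Structure N] [Unique M] [Unique N],
      Forb L F M → Forb L F N → Nonempty (M ≃[L] N)) :
    ∃ (U : Type) (_ : L.Structure U), IsUniversal L F U ∧ IsWeaklyIndivisible L U := by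
  by_cases hc : IsCovered L F
  · exact exists_universal_of_covered hc hF (loopFree_of_unique hc h)
  -- In this degenerate case the class contains only the empty structure, which is itself universal.
  · let := ofRels (fun _ _ _ => False : Rels L Empty)
    have hemp : ∀ (M N : Type) [L.Structure M] [L.Structure N], IsEmpty M → Nonempty (M ↪[L] N) :=
      fun M N _ _ _ => ⟨embOf (fun a => isEmptyElim a) (fun a => isEmptyElim a) (fun n R t => by
        obtain ⟨k, -⟩ := Gluing.exists_fin R
        exact isEmptyElim (t k))⟩
    refine ⟨Empty, ofRels fun _ _ _ => False, ⟨inferInstance, fun j => ⟨fun f => ?_⟩, ?_⟩, ?_⟩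
    · exact isEmptyElim (f (Classical.arbitrary (F j)))
    · intro M _ _ hM
      exact hemp M Empty (isEmpty_of_not_isCovered hF hc M hM)
    · intro A B _ _ _
      exact hemp Empty (induced L B) inferInstance

end

end WeakIndiv

theorem mainTheorem7
    (L : FirstOrder.Language.{0, 0}) [L.IsRelational] [Finite (Σ n, L.Relations n)]
    [IsEmpty (L.Relations 0)]
    {ι : Type} [Finite ι] (F : ι → Type) [∀ j, L.Structure (F j)]
    [∀ j, Finite (F j)] [∀ j, Nonempty (F j)]
    (hF : WeakIndiv.IsMinimalFamily L F) :
    ((∀ (M N : Type) [L.Structure M] [L.Structure N] [Unique M] [Unique N],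
        WeakIndiv.Forb L F M → WeakIndiv.Forb L F N → Nonempty (M ≃[L] N)) →
      (∀ (j : ι) (A : Type) [L.Structure A], WeakIndiv.IsHomImage L (F j) A →
        ∀ C : Set A, WeakIndiv.IsMinimalCut L A C →
          2 ≤ C.ncard ∧
          WeakIndiv.IsConnected L (WeakIndiv.induced L C) ∧
          ∀ c : WeakIndiv.induced L C, ¬ WeakIndiv.IsCut L (WeakIndiv.induced L C) {c}) →
      ∃ (U : Type) (_ : L.Structure U),
        WeakIndiv.IsUniversal L F U ∧ WeakIndiv.IsWeaklyIndivisible L U) ∧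
    ((∃ (j : ι) (A : Type) (_ : L.Structure A), WeakIndiv.IsMinimalHomImage L F j A ∧
        ∃ c : A, WeakIndiv.IsCut L A {c}) →
      ∀ (U : Type) [L.Structure U], WeakIndiv.IsUniversal L F U →
        WeakIndiv.IsDivisible L U ∧ ¬ WeakIndiv.IsWeaklyIndivisible L U) := by
  constructor
  · intro h hcut
    exact WeakIndiv.exists_universal (fun j A _ hA C hC =>
      ⟨(hcut j A hA C hC).1, (hcut j A hA C hC).2.1.connIn⟩) h
  · rintro ⟨j, A, _, hA, c, hc⟩ U _ hU
    exact WeakIndiv.isDivisible_of_isCut_singleton F hA hc hU
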